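/- Let $X$ be a finite set, $\mathcal M=(X,\mathcal I)$ a matroid with rank function $r_{\mathcal M}$, and $f:2^X\to\mathbb R_{\ge 0}$ a nonnegative (not necessarily monotone) submodular function, i.e. $f(S\cup T)+f(S\cap T)\le f(S)+f(T)$ for all $S,T\subseteq X$. Put $OPT=\max\{f(S):S\in\mathcal I\}$ and $F(\mathbf x)=\sum_{S\subseteq X}f(S)\prod_{i\in S}x_i\prod_{j\notin S}(1-x_j)$. For a matroid $\mathcal N$ let $P(\mathcal N)$ and $B(\mathcal N)$ be the convex hulls of the characteristic vectors of its independent sets and of its bases, respectively, and let $P_t(\mathcal M)=P(\mathcal M)\cap[0,t]^X$. Let $t=\frac rq\in\left[0,\frac12(3-\sqrt5)\right]$ with integers $0\le r\le q$, $q\ge1$, and let $\delta=\frac1q$. Consider the following algorithm, in which all choices that are left open are arbitrary. 1. (Fractional local search over $P_t(\mathcal M)$.) Start with $\mathbf x=\mathbf 0$. While there are $i,j\in X$ and $\mathbf v\in\{\mathbf e_j,-\mathbf e_i,\mathbf e_j-\mathbf e_i\}$ with $\mathbf x+\delta\mathbf v\in P_t(\mathcal M)$ and $F(\mathbf x+\delta\mathbf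 v)>F(\mathbf x)$, set $\mathbf x:=\mathbf x+\delta\mathbf v$. 2. (Adjust.) Let $\mathcal N:=\mathcal M$. While $\mathbf x\notin B(\mathcal N)$: (a) if there are $i$ and $\varepsilon>0$ with $\mathbf x+\varepsilon\mathbf e_i\in P(\mathcal N)$, choose such an $i$, let $x_{\max}=x_i+\max\{\varepsilon:\mathbf x+\varepsilon\mathbf e_i\in P(\mathcal N)\}$, and set $x_i:=x_{\max}$ with probability $x_i/x_{\max}$ and $x_i:=0$ otherwise; (b) then, if there is an $i$ in the ground set of $\mathcal N$ with $x_i=0$, choose one and delete it from $\mathcal N$ and from $\mathbf x$. 3. (Randomized pipage rounding.) Let $\mathbf y:=\mathbf x$. While $\mathbf y$ is not integral: let $T$ be the ground set of $\mathcal N$, and while $T$ contains fractional variables, pick two of them, $i\ne j$; let $(\mathbf y^+,A^+)=\mathrm{HC}(\mathbf y,i,j)$, $(\mathbf y^-,A^-)=\mathrm{HC}(\mathbf y,j,i)$ and $p=\|\mathbf y^+-\mathbf y\|/\|\mathbf y^+-\mathbf y^-\|$ (any $p\in[0,1]$ if $\mathbf y^+=\mathbf y^-$); with probability $p$ set $\mathbf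 y:=\mathbf y^-$, $T:=T\cap A^-$, and otherwise set $\mathbf y:=\mathbf y^+$, $T:=T\cap A^+$. Here $\mathrm{HC}(\mathbf y,i,j)$ finds a subset $A$ of the ground set of $\mathcal N$ with $i\in A$, $j\notin A$ that minimizes $\gamma=r_{\mathcal N}(A)-\sum_{a\in A}y_a$; if $y_j<\gamma$ it replaces $\gamma$ by $y_j$ and $A$ by $\{j\}$; it returns $(\mathbf y+\gamma(\mathbf e_i-\mathbf e_j),A)$. When $\mathbf y$ is integral, return $S=\{i:y_i=1\}$. Then, whatever choices are made and whatever the outcomes of the random draws, the algorithm halts after finitely many steps. The returned random set $S$ is always independent, $S\in\mathcal I$, and its expected value satisfies $$\mathbf E[f(S)]\ \ge\ \left(t-\tfrac12t^2\right)OPT.$$ -/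

import Mathlib

open scoped NNReal

noncomputable section

namespace FractionalSearch

/-! ### Set functions, multilinear extension, matroid polytopes -/

/-- `f : 2^X → ℝ` is submodular. -/
def IsSubmodular {X : Type*} [DecidableEq X] (f : Finset X → ℝ) : Prop :=
  ∀ S T : Finset X, f (S ∪ T) + f (S ∩ T) ≤ f S + f T

/-- The multilinear extension `F(x) = ∑_S f(S) ∏_{i ∈ S} x_i ∏_{j ∉ S} (1 - x_j)`. -/
def multilinearExt {X : Type*} [Fintype X] [DecidableEq X] (f : Finset X → ℝ) (x : X → ℝ) : ℝ :=
  ∑ S : Finset X, f S * ((∏ i ∈ S, x i) * ∏ j ∈ Sᶜ, (1 - x j))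

/-- The characteristic vector `1_S` of a set. -/
def charVec {X : Type*} (S : Set X) : X → ℝ := S.indicator (fun _ => 1)

/-- The standard basis vector `e_i`. -/
def stdVec {X : Type*} [DecidableEq X] (i : X) : X → ℝ := Pi.single i 1

/-- The matroid polytope `P(N)`, the convex hull of the characteristic vectors of the independent
sets. For a matroid `N` on a subset `N.E` of `X` its points are regarded as vectors indexed
by `X` that vanish outside `N.E`. -/
def polytope {X : Type*} (N : Matroid X) : Set (X → ℝ) :=
  convexHull ℝ {v | ∃ I : Set X, N.Indep I ∧ v = charVec I}

/-- The matroid base polytope `B(N)`, the convex hull of the characteristic vectors of the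
bases. -/
def basePolytope {X : Type*} (N : Matroid X) : Set (X → ℝ) :=
  convexHull ℝ {v | ∃ B : Set X, N.IsBase B ∧ v = charVec B}

/-- `P_t(N) = P(N) ∩ [0,t]^X`. -/
def boxedPolytope {X : Type*} (N : Matroid X) (t : ℝ) : Set (X → ℝ) :=
  polytope N ∩ {x | ∀ i, 0 ≤ x i ∧ x i ≤ t}

/-- The rank function of a matroid on a finite type, as a real number. -/
def rank {X : Type*} (N : Matroid X) (A : Finset X) : ℝ := ((N.eRk (A : Set X)).toNat : ℝ)

/-- A fractional value of a variable in `[0,1]`. -/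
def IsFractional (a : ℝ) : Prop := 0 < a ∧ a < 1

/-! ### The algorithm, as a randomized nondeterministic transition system -/

/-- The configurations of the algorithm (fractional local search, then the procedure Adjust, then
the procedure PipageRound).
* `search x`: at the loop test of the local search, current point `x`;
* `adjust N x`: at the loop test of Adjust, current matroid `N` and point `x`;
* `adjustDelete N x`: in the loop of Adjust, before the deletion of a zero coordinate;
* `outer N y`: at the test of the outer loop of PipageRound;
* `inner N y T`: at the test of the inner loop of PipageRound;
* `done S`: halted with output `S`. -/
inductive State (X : Type*) where
  | search (x : X → ℝ) : State X
  | adjust (N : Matroid X) (x : X → ℝ) : State X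
  | adjustDelete (N : Matroid X) (x : X → ℝ) : State X
  | outer (N : Matroid X) (y : X → ℝ) : State X
  | inner (N : Matroid X) (y : X → ℝ) (T : Set X) : State X
  | done (S : Finset X) : State X

/-- The distribution that is `a` with probability `p` and `b` with probability `1 - p`. -/
def coin {σ : Type*} (p : ℝ≥0) (hp : p ≤ 1) (a b : σ) : PMF σ :=
  (PMF.ofFintype (fun c : Bool => ((if c then p else 1 - p : ℝ≥0) : ENNReal)) (by
    rw [Fintype.sum_bool]
    simp only [if_true, Bool.false_eq_true, if_false]
    rw [← ENNReal.coe_add, add_tsub_cancel_of_le hp, ENNReal.coe_one])).map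
    (fun c => if c then a else b)

/-- `(y', A')` is a possible result of the subroutine HitConstraint`(y, i, j)` for the matroid `N`:
`A` attains `δ = min (r(A) - y(A))` over the sets `A ⊆ N.E` with `i ∈ A`, `j ∉ A`; if `y_j < δ`
then `δ` is replaced by `y_j` and `A` by `{j}`; then `δ` is moved from `y_j` to `y_i`. -/
def HitConstraint {X : Type*} [DecidableEq X] (N : Matroid X) (y : X → ℝ) (i j : X)
    (y' : X → ℝ) (A' : Finset X) : Prop :=
  ∃ A : Finset X, ((A : Set X) ⊆ N.E ∧ i ∈ A ∧ j ∉ A) ∧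
    (∀ B : Finset X, (B : Set X) ⊆ N.E → i ∈ B → j ∉ B →
      rank N A - ∑ a ∈ A, y a ≤ rank N B - ∑ b ∈ B, y b) ∧
    ((y j < rank N A - ∑ a ∈ A, y a ∧
        y' = y + y j • (stdVec i - stdVec j) ∧ A' = {j}) ∨
      (rank N A - ∑ a ∈ A, y a ≤ y j ∧
        y' = y + (rank N A - ∑ a ∈ A, y a) • (stdVec i - stdVec j) ∧ A' = A))

/-- An improving step of the local search over `P_t(M)` with step length `δ`: from `x` to
`x' = x + δ v ∈ P_t(M)` with `v ∈ {e_j, -e_i, e_j - e_i}` and `F(x') > F(x)`. -/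
def Improves {X : Type*} [Fintype X] [DecidableEq X] (M : Matroid X) (f : Finset X → ℝ)
    (t δ : ℝ) (x x' : X → ℝ) : Prop :=
  ∃ i j : X, ∃ v ∈ ({stdVec j, -stdVec i, stdVec j - stdVec i} : Set (X → ℝ)),
    x' = x + δ • v ∧ x' ∈ boxedPolytope M t ∧ multilinearExt f x < multilinearExt f x'

/-- `Step M f t δ s μ`: in configuration `s` the algorithm may choose to make a step whose random
result has the distribution `μ`. Choices that the algorithm leaves open (of an improving direction,
of a coordinate, of an optimal set) are all allowed; a coin toss is a proper distribution. -/
inductive Step {X : Type*} [Fintype X] [DecidableEq X] (M : Matroid X) (f : Finset X → ℝ)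
    (t δ : ℝ) : State X → PMF (State X) → Prop
  /-- an improving local step -/
  | move (x x' : X → ℝ) (h : Improves M f t δ x x') :
      Step M f t δ (.search x) (PMF.pure (.search x'))
  /-- no improving local step exists: start the rounding -/
  | localOpt (x : X → ℝ) (h : ¬ ∃ x', Improves M f t δ x x') :
      Step M f t δ (.search x) (PMF.pure (.adjust M x))
  /-- Adjust, `x ∉ B(N)`, some `x_i` can be increased, to `x_i + ε` at most: with
  `p = x_i / (x_i + ε)`, set `x_i` to `x_i + ε` with probability `p` and to `0` otherwise -/
  | raise (N : Matroid X) (x : X → ℝ) (i : X) (ε : ℝ) (p : ℝ≥0) (hp : p ≤ 1)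
      (hx : x ∉ basePolytope N) (hi : i ∈ N.E)
      (hε : IsGreatest {d : ℝ | x + d • stdVec i ∈ polytope N} ε) (hε0 : 0 < ε)
      (hpx : (p : ℝ) = x i / (x i + ε)) :
      Step M f t δ (.adjust N x)
        (coin p hp (.adjustDelete N (Function.update x i (x i + ε)))
          (.adjustDelete N (Function.update x i 0)))
  /-- Adjust, `x ∉ B(N)`, no `x_i` can be increased -/
  | noRaise (N : Matroid X) (x : X → ℝ) (hx : x ∉ basePolytope N)
      (h : ¬ ∃ i ∈ N.E, ∃ ε : ℝ, 0 < ε ∧ x + ε • stdVec i ∈ polytope N) :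
      Step M f t δ (.adjust N x) (PMF.pure (.adjustDelete N x))
  /-- Adjust: a coordinate with `x_i = 0` is deleted from the matroid -/
  | delete (N : Matroid X) (x : X → ℝ) (i : X) (hi : i ∈ N.E) (hxi : x i = 0) :
      Step M f t δ (.adjustDelete N x) (PMF.pure (.adjust (N.delete {i}) x))
  /-- Adjust: there is no coordinate with `x_i = 0` -/
  | noDelete (N : Matroid X) (x : X → ℝ) (h : ∀ i ∈ N.E, x i ≠ 0) :
      Step M f t δ (.adjustDelete N x) (PMF.pure (.adjust N x))
  /-- Adjust ends with a point of `B(N)`, which is handed to PipageRound -/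
  | adjusted (N : Matroid X) (x : X → ℝ) (hx : x ∈ basePolytope N) :
      Step M f t δ (.adjust N x) (PMF.pure (.outer N x))
  /-- PipageRound, `y` not integral: start the inner loop with `T` the ground set -/
  | enter (N : Matroid X) (y : X → ℝ) (hy : ∃ i ∈ N.E, IsFractional (y i)) :
      Step M f t δ (.outer N y) (PMF.pure (.inner N y N.E))
  /-- PipageRound, `T` contains fractional variables: two of them, `i ≠ j`, are picked, and with
  `p = ‖y⁺ - y‖ / ‖y⁺ - y⁻‖` (Euclidean norms) the algorithm moves to `y⁻` with probability `p` and
  to `y⁺` otherwise. If `y⁺ = y⁻ = y`, every `p` is admitted. -/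
  | pipage (N : Matroid X) (y : X → ℝ) (T : Set X) (i j : X) (hij : i ≠ j)
      (hi : i ∈ T ∧ IsFractional (y i)) (hj : j ∈ T ∧ IsFractional (y j))
      (yp ym : X → ℝ) (Ap Am : Finset X)
      (hyp : HitConstraint N y i j yp Ap) (hym : HitConstraint N y j i ym Am)
      (p : ℝ≥0) (hp : p ≤ 1)
      (hpy : (p : ℝ) * ‖WithLp.toLp 2 (yp - ym)‖ = ‖WithLp.toLp 2 (yp - y)‖) :
      Step M f t δ (.inner N y T)
        (coin p hp (.inner N ym (T ∩ (Am : Set X))) (.inner N yp (T ∩ (Ap : Set X))))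
  /-- PipageRound, `T` contains no fractional variables: leave the inner loop -/
  | leave (N : Matroid X) (y : X → ℝ) (T : Set X) (h : ∀ i ∈ T, ¬ IsFractional (y i)) :
      Step M f t δ (.inner N y T) (PMF.pure (.outer N y))
  /-- PipageRound, `y` integral: return the set with characteristic vector `y` -/
  | halt (N : Matroid X) (y : X → ℝ) (hy : ∀ i ∈ N.E, ¬ IsFractional (y i)) :
      Step M f t δ (.outer N y)
        (PMF.pure (.done (Finset.univ.filter fun i => y i = 1)))

/-- `s'` is a possible successor of `s`, i.e. it has positive probability in some step. -/
def Succ {X : Type*} (step : State X → PMF (State X) → Prop) (s s' : State X) : Prop :=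
  ∃ μ, step s μ ∧ s' ∈ μ.support

/-- From `s₀`, the algorithm halts after finitely many steps whatever choices are made and however
the coins fall: there is no infinite run, and no reachable configuration other than a halted
one is without a next step. -/
def AlwaysHalts {X : Type*} (step : State X → PMF (State X) → Prop) (s₀ : State X) : Prop :=
  (¬ ∃ s : ℕ → State X, s 0 = s₀ ∧ ∀ n, Succ step (s n) (s (n + 1))) ∧
  ∀ s, Relation.ReflTransGen (Succ step) s₀ s → (∃ S, s = .done S) ∨ ∃ μ, step s μ

/-- `Output step s ν`: under some way of making the choices (which may depend on the random past),
the output of the algorithm started in `s` has the distribution `ν`. -/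
inductive Output {X : Type*} (step : State X → PMF (State X) → Prop) :
    State X → PMF (Finset X) → Prop
  | done (S : Finset X) : Output step (.done S) (PMF.pure S)
  | step (s : State X) (μ : PMF (State X)) (ν : State X → PMF (Finset X)) (h : step s μ)
      (hν : ∀ s' ∈ μ.support, Output step s' (ν s')) : Output step s (μ.bind ν)

/-- The expected value `E[f(S)]` of a random set `S` with distribution `ν`. -/
def expectedValue {X : Type*} [Fintype X] (f : Finset X → ℝ) (ν : PMF (Finset X)) : ℝ :=
  ∑ S : Finset X, (ν S).toReal * f S

end FractionalSearch

end

/-! Fix an optimal independent set C. Each configuration carries a value that no step lowers in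
expectation: the constant (t - t²/2) f(C) during the search, and F at the current point afterwards.
The theorem thus splits into a deterministic bound at local optima (`localOpt_ge`) and the fact that
the rounding does not lose value on average.

Local optima. Submodularity makes all mixed second derivatives of F nonpositive. Hence F is affine
along each e_i, concave along nonnegative directions and convex along e_j - e_i, so a step of
positive length that fails to improve already yields a first order inequality. The points, t and all
ranks are multiples of 1/q, so a constraint that is not tight leaves room for a full step.
Uncrossing tight sets then shows that x maximizes the linear function given by its own gradient over
P_t(M) (`localOpt_first_order`). Testing this with z = t on C and (1-t)x off C, and bounding F from
below by concavity (`multilinearExt_raise_ge`), gives t(1-t) f(C) ≤ 2t F(x) + (1-3t+t²) F(x_C),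
where x_C is x restricted to C. The last coefficient is nonnegative in the given range of t, and
F(x_C) ≤ F(x) finishes the bound.

Rounding. In Adjust one coordinate moves with its mean preserved, so the expectation of F is
unchanged. A pipage step moves along e_i - e_j with mean zero, so by convexity the expectation does
not drop. `HitConstraint` makes T ∩ A either tight or free of fractional variables. Since ranks are
integers, a tight set never contains exactly one fractional variable, so a pair is always available.
Termination follows from a lexicographic measure: the phase, then a bound for the work left in it.
-/

namespace FractionalSearch

set_option linter.unusedSectionVars false

/-! ### Multilinear extension of a submodular function: derivatives and concavity -/

section Multilinear

variable {X : Type*} [Fintype X] [DecidableEq X]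

/-- The unit box `[0,1]^X`. -/
def InBox {X : Type*} (x : X → ℝ) : Prop := ∀ i, 0 ≤ x i ∧ x i ≤ 1

/-- The probability that the random set with independent marginals `x` equals `S`. -/
def weight (x : X → ℝ) (S : Finset X) : ℝ := ∏ j, if j ∈ S then x j else 1 - x j

/-- The marginal value `S ↦ f (S + i) - f (S - i)`. -/
def marginal (f : Finset X → ℝ) (i : X) (S : Finset X) : ℝ := f (insert i S) - f (S.erase i)

/-- The partial derivative of the multilinear extension. -/
def pd (f : Finset X → ℝ) (i : X) (x : X → ℝ) : ℝ := multilinearExt (marginal f i) x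

lemma multilinearExt_eq_sum_weight (f : Finset X → ℝ) (x : X → ℝ) :
    multilinearExt f x = ∑ S : Finset X, f S * weight x S := by
  unfold multilinearExt weight
  refine Finset.sum_congr rfl fun S _ => ?_
  congr 1
  rw [Finset.prod_ite]
  congr 1
  · congr 1; ext; simp
  · congr 1; ext; simp

lemma weight_nonneg {x : X → ℝ} (hx : InBox x) (S : Finset X) : 0 ≤ weight x S := by
  refine Finset.prod_nonneg fun j _ => ?_
  split_ifs
  · exact (hx j).1
  · linarith [(hx j).2]

lemma sum_weight (x : X → ℝ) : ∑ S : Finset X, weight x S = 1 := by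
  have h := Finset.prod_add (fun i => x i) (fun i => 1 - x i) (Finset.univ : Finset X)
  simp only [add_sub_cancel, Finset.prod_const_one, Finset.powerset_univ] at h
  rw [h]
  refine Finset.sum_congr rfl fun S _ => ?_
  unfold weight
  rw [Finset.prod_ite]
  congr 1
  · congr 1; ext; simp
  · congr 1; ext; simp

lemma sum_finset_eq (g : Finset X → ℝ) (i : X) :
    ∑ S : Finset X, g S = ∑ S ∈ (Finset.univ.erase i).powerset, (g S + g (insert i S)) := by
  rw [Finset.sum_add_distrib, ← Finset.sum_powerset_insert (Finset.notMem_erase i _),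
    Finset.insert_erase (Finset.mem_univ i), Finset.powerset_univ]

lemma weight_eq_mul (x : X → ℝ) (S : Finset X) (i : X) :
    weight x S = (if i ∈ S then x i else 1 - x i) *
      ∏ j ∈ Finset.univ.erase i, if j ∈ S then x j else 1 - x j := by
  unfold weight
  rw [← Finset.mul_prod_erase _ _ (Finset.mem_univ i)]

/-- Pair each set S avoiding i with S + i. This is the source of all later formulas: F is affine in
every single coordinate. -/
lemma multilinearExt_update (f : Finset X → ℝ) (x : X → ℝ) (i : X) (s : ℝ) :
    multilinearExt f (Function.update x i s) =
      s * multilinearExt (fun S => f (insert i S)) x +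
        (1 - s) * multilinearExt (fun S => f (S.erase i)) x := by
  simp only [multilinearExt_eq_sum_weight]
  rw [sum_finset_eq _ i, sum_finset_eq _ i, sum_finset_eq _ i, Finset.mul_sum, Finset.mul_sum,
    ← Finset.sum_add_distrib]
  refine Finset.sum_congr rfl fun S hS => ?_
  have hi : i ∉ S := fun h => Finset.notMem_erase i _ (Finset.mem_powerset.1 hS h)
  set W := ∏ j ∈ Finset.univ.erase i, if j ∈ S then x j else 1 - x j with hW
  have e1 : weight (Function.update x i s) S = (1 - s) * W := by
    rw [weight_eq_mul _ _ i, if_neg hi, Function.update_self, hW]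
    congr 1
    refine Finset.prod_congr rfl fun j hj => ?_
    rw [Function.update_of_ne (Finset.ne_of_mem_erase hj)]
  have e2 : weight (Function.update x i s) (insert i S) = s * W := by
    rw [weight_eq_mul _ _ i, if_pos (Finset.mem_insert_self _ _), Function.update_self, hW]
    congr 1
    refine Finset.prod_congr rfl fun j hj => ?_
    rw [Function.update_of_ne (Finset.ne_of_mem_erase hj)]
    simp [Finset.ne_of_mem_erase hj]
  have e3 : weight x S = (1 - x i) * W := by
    rw [weight_eq_mul _ _ i, if_neg hi, hW]
  have e4 : weight x (insert i S) = x i * W := by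
    rw [weight_eq_mul _ _ i, if_pos (Finset.mem_insert_self _ _), hW]
    congr 1
    refine Finset.prod_congr rfl fun j hj => ?_
    simp [Finset.ne_of_mem_erase hj]
  rw [e1, e2, e3, e4, Finset.erase_insert hi, Finset.erase_eq_of_notMem hi,
    Finset.insert_idem]
  ring

lemma multilinearExt_sub (f g : Finset X → ℝ) (x : X → ℝ) :
    multilinearExt (fun S => f S - g S) x = multilinearExt f x - multilinearExt g x := by
  simp only [multilinearExt_eq_sum_weight, sub_mul, Finset.sum_sub_distrib]

lemma multilinearExt_mono_of_weight {f g : Finset X → ℝ} {x : X → ℝ} (hx : InBox x)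
    (h : ∀ S, weight x S ≠ 0 → f S ≤ g S) : multilinearExt f x ≤ multilinearExt g x := by
  simp only [multilinearExt_eq_sum_weight]
  refine Finset.sum_le_sum fun S _ => ?_
  by_cases hS : weight x S = 0
  · simp [hS]
  · exact mul_le_mul_of_nonneg_right (h S hS) (weight_nonneg hx S)

lemma multilinearExt_nonneg {f : Finset X → ℝ} (hf : ∀ S, 0 ≤ f S) {x : X → ℝ} (hx : InBox x) :
    0 ≤ multilinearExt f x := by
  rw [multilinearExt_eq_sum_weight]
  exact Finset.sum_nonneg fun S _ => mul_nonneg (hf S) (weight_nonneg hx S)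

lemma multilinearExt_nonpos {f : Finset X → ℝ} (hf : ∀ S, f S ≤ 0) {x : X → ℝ} (hx : InBox x) :
    multilinearExt f x ≤ 0 := by
  rw [multilinearExt_eq_sum_weight]
  exact Finset.sum_nonpos fun S _ => mul_nonpos_of_nonpos_of_nonneg (hf S) (weight_nonneg hx S)

lemma multilinearExt_const (c : ℝ) (x : X → ℝ) : multilinearExt (fun _ => c) x = c := by
  rw [multilinearExt_eq_sum_weight, ← Finset.mul_sum, sum_weight, mul_one]

lemma multilinearExt_mem (i : X) (x : X → ℝ) :
    multilinearExt (fun S => if i ∈ S then 1 else 0) x = x i := by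
  have h := multilinearExt_update (fun S => if i ∈ S then 1 else 0) x i (x i)
  rw [Function.update_eq_self] at h
  simpa [multilinearExt_const] using h

lemma multilinearExt_modular (a : ℝ) (m : X → ℝ) (x : X → ℝ) :
    multilinearExt (fun S => a + ∑ i ∈ S, m i) x = a + ∑ i, m i * x i := by
  have h2 : ∀ i, ∑ S : Finset X, (if i ∈ S then 1 else 0) * weight x S = x i := fun i => by
    rw [← multilinearExt_eq_sum_weight, multilinearExt_mem]
  rw [multilinearExt_eq_sum_weight]
  simp only [add_mul, Finset.sum_add_distrib]
  rw [← Finset.mul_sum, sum_weight, mul_one]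
  congr 1
  have : ∀ S : Finset X, (∑ i ∈ S, m i) * weight x S
      = ∑ i, m i * ((if i ∈ S then 1 else 0) * weight x S) := fun S => by
    rw [Finset.sum_mul, ← Finset.sum_subset (Finset.subset_univ S)]
    · refine Finset.sum_congr rfl fun i hi => by simp [hi]
    · intro i _ hi; simp [hi]
  simp only [this]
  rw [Finset.sum_comm]
  refine Finset.sum_congr rfl fun i _ => ?_
  rw [← Finset.mul_sum, h2]

lemma multilinearExt_indicator (f : Finset X → ℝ) (C : Finset X) {x : X → ℝ}
    (hx : ∀ i, x i = if i ∈ C then 1 else 0) : multilinearExt f x = f C := by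
  rw [multilinearExt_eq_sum_weight, Finset.sum_eq_single C]
  · have : weight x C = 1 := Finset.prod_eq_one fun j _ => by rw [hx]; split_ifs <;> simp
    rw [this, mul_one]
  · intro S _ hS
    have : weight x S = 0 := by
      obtain ⟨j, hj⟩ : ∃ j, ¬ (j ∈ S ↔ j ∈ C) := by
        by_contra! h; exact hS (Finset.ext h)
      refine Finset.prod_eq_zero (Finset.mem_univ j) ?_
      rw [hx]
      by_cases h1 : j ∈ S <;> by_cases h2 : j ∈ C <;> simp_all
    rw [this, mul_zero]
  · simp

lemma multilinearExt_update_eq (f : Finset X → ℝ) (x : X → ℝ) (i : X) (s : ℝ) :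
    multilinearExt f (Function.update x i s) = multilinearExt f x + (s - x i) * pd f i x := by
  have h1 := multilinearExt_update f x i s
  have h2 := multilinearExt_update f x i (x i)
  rw [Function.update_eq_self] at h2
  unfold pd marginal
  rw [multilinearExt_sub, h1, h2]
  ring

/-- Diminishing returns: submodularity for S - j + i and S + j - i. -/
lemma marginal_insert_le {f : Finset X → ℝ} (hf : IsSubmodular f) (i j : X) (S : Finset X) :
    marginal f i (insert j S) ≤ marginal f i (S.erase j) := by
  unfold marginal
  have h := hf (insert i (S.erase j)) ((insert j S).erase i)
  have e1 : insert i (S.erase j) ∪ (insert j S).erase i = insert i (insert j S) := by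
    ext a; simp; tauto
  have e2 : insert i (S.erase j) ∩ (insert j S).erase i = (S.erase j).erase i := by
    ext a; simp; tauto
  rw [e1, e2] at h
  linarith

lemma pd_marginal_nonpos {f : Finset X → ℝ} (hf : IsSubmodular f) (i j : X) {x : X → ℝ}
    (hx : InBox x) : pd (marginal f i) j x ≤ 0 :=
  multilinearExt_nonpos (fun S => by
    have := marginal_insert_le hf i j S
    unfold marginal at this ⊢
    linarith) hx

lemma inBox_piecewise {x y : X → ℝ} (hx : InBox x) (hy : InBox y) (S : Finset X) :
    InBox (S.piecewise y x) := fun i => by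
  by_cases h : i ∈ S <;> simp [h, hx i, hy i]

/-- Pass from x to y one coordinate at a time; each move changes the derivative by a nonnegative
multiple of a mixed second derivative. -/
lemma pd_antitone {f : Finset X → ℝ} (hf : IsSubmodular f) (i : X) {x y : X → ℝ}
    (hx : InBox x) (hy : InBox y) (hxy : x ≤ y) : pd f i y ≤ pd f i x := by
  have key : ∀ S : Finset X, pd f i (S.piecewise y x) ≤ pd f i x := by
    intro S
    induction S using Finset.induction_on with
    | empty => simp
    | insert j S hj ih =>
      rw [Finset.piecewise_insert]
      unfold pd at ih ⊢
      rw [multilinearExt_update_eq, Finset.piecewise_eq_of_notMem _ _ _ hj]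
      have := mul_nonpos_of_nonneg_of_nonpos (sub_nonneg.2 (hxy j))
        (pd_marginal_nonpos hf i j (inBox_piecewise hx hy S))
      linarith
  simpa using key Finset.univ

/-- Along a coordinatewise path from x to y each increment is exactly affine, and its slope lies
between the partial derivatives at y and at x. -/
lemma multilinearExt_sub_bounds {f : Finset X → ℝ} (hf : IsSubmodular f) {x y : X → ℝ}
    (hx : InBox x) (hy : InBox y) (hxy : x ≤ y) :
    multilinearExt f y - multilinearExt f x ≤ ∑ i, (y i - x i) * pd f i x ∧
      ∑ i, (y i - x i) * pd f i y ≤ multilinearExt f y - multilinearExt f x := by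
  have key : ∀ S : Finset X,
      multilinearExt f (S.piecewise y x) - multilinearExt f x ≤ ∑ i ∈ S, (y i - x i) * pd f i x ∧
      ∑ i ∈ S, (y i - x i) * pd f i y ≤
        multilinearExt f (S.piecewise y x) - multilinearExt f x := by
    intro S
    induction S using Finset.induction_on with
    | empty => simp
    | insert j S hj ih =>
      have hz := inBox_piecewise hx hy S
      have h1 : pd f j (S.piecewise y x) ≤ pd f j x :=
        pd_antitone hf j hx hz (Finset.le_piecewise_of_le_of_le _ hxy le_rfl)
      have h2 : pd f j y ≤ pd f j (S.piecewise y x) :=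
        pd_antitone hf j hz hy (Finset.piecewise_le_of_le_of_le _ le_rfl hxy)
      rw [Finset.piecewise_insert, multilinearExt_update_eq,
        Finset.piecewise_eq_of_notMem _ _ _ hj, Finset.sum_insert hj, Finset.sum_insert hj]
      have h3 := mul_le_mul_of_nonneg_left h1 (sub_nonneg.2 (hxy j))
      have h4 := mul_le_mul_of_nonneg_left h2 (sub_nonneg.2 (hxy j))
      constructor <;> linarith [ih.1, ih.2]
  simpa using key Finset.univ

/-- The multilinear extension of a submodular function is concave along nonnegative
directions. -/
lemma multilinearExt_concave {f : Finset X → ℝ} (hf : IsSubmodular f) {x y u : X → ℝ} {t : ℝ}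
    (ht0 : 0 ≤ t) (ht1 : t ≤ 1) (hx : InBox x) (hy : InBox y) (hxy : x ≤ y)
    (hu : ∀ i, u i = (1 - t) * x i + t * y i) :
    (1 - t) * multilinearExt f x + t * multilinearExt f y ≤ multilinearExt f u := by
  have hxu : x ≤ u := fun i => by
    rw [hu]; nlinarith [mul_nonneg ht0 (sub_nonneg.2 (hxy i))]
  have huy : u ≤ y := fun i => by
    rw [hu]; nlinarith [mul_nonneg (sub_nonneg.2 ht1) (sub_nonneg.2 (hxy i))]
  have hub : InBox u := fun i => ⟨(hx i).1.trans (hxu i), (huy i).trans (hy i).2⟩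
  -- Both increments are compared with the gradient at u; weighted by 1 - t and t, the two linear
  -- terms cancel.
  have h1 := (multilinearExt_sub_bounds hf hx hub hxu).2
  have h2 := (multilinearExt_sub_bounds hf hub hy huy).1
  have e1 : ∑ i, (u i - x i) * pd f i u = t * ∑ i, (y i - x i) * pd f i u := by
    rw [Finset.mul_sum]; exact Finset.sum_congr rfl fun i _ => by rw [hu]; ring
  have e2 : ∑ i, (y i - u i) * pd f i u = (1 - t) * ∑ i, (y i - x i) * pd f i u := by
    rw [Finset.mul_sum]; exact Finset.sum_congr rfl fun i _ => by rw [hu]; ring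
  rw [e1] at h1
  rw [e2] at h2
  have h3 := mul_le_mul_of_nonneg_left h1 (sub_nonneg.2 ht1)
  have h4 := mul_le_mul_of_nonneg_left h2 ht0
  nlinarith

lemma add_smul_stdVec_sub (y : X → ℝ) {i j : X} (hij : i ≠ j) (s : ℝ) :
    y + s • (stdVec i - stdVec j) =
      Function.update (Function.update y i (y i + s)) j (y j - s) := by
  ext a
  simp only [Pi.add_apply, Pi.smul_apply, Pi.sub_apply, stdVec, smul_eq_mul]
  by_cases ha : a = j
  · subst ha; simp [hij.symm]; ring
  · by_cases hb : a = i
    · subst hb; simp [ha]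
    · simp [ha, hb]

/-- For submodular f the mixed derivative on the right is nonpositive, so F is convex in s. Both the
local search and the pipage rounding rest on this. -/
lemma multilinearExt_exchange (f : Finset X → ℝ) (y : X → ℝ) {i j : X} (hij : i ≠ j) (s : ℝ) :
    multilinearExt f (y + s • (stdVec i - stdVec j)) = multilinearExt f y +
      s * (pd f i y - pd f j y) - s ^ 2 * pd (marginal f j) i y := by
  rw [add_smul_stdVec_sub y hij, multilinearExt_update_eq, multilinearExt_update_eq,
    Function.update_of_ne hij.symm]
  have : pd f j (Function.update y i (y i + s)) = pd f j y + s * pd (marginal f j) i y := by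
    change multilinearExt _ _ = _
    rw [multilinearExt_update_eq]
    simp [pd]
  rw [this]
  ring

/-- A submodular function has a modular minorant below every set, exact at that set. -/
lemma exists_modular_minorant {f : Finset X → ℝ} (hf : IsSubmodular f) (C : Finset X) :
    ∃ m : X → ℝ, (∀ S ⊆ C, f ∅ + ∑ i ∈ S, m i ≤ f S) ∧ f ∅ + ∑ i ∈ C, m i = f C := by
  induction C using Finset.induction_on with
  | empty => exact ⟨0, by simp +contextual [Finset.subset_empty], by simp⟩
  | insert c C hc ih =>
    obtain ⟨m, h1, h2⟩ := ih
    have hsum : ∀ S : Finset X, c ∉ S →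
        ∑ i ∈ S, Function.update m c (f (insert c C) - f C) i = ∑ i ∈ S, m i := fun S hS =>
      Finset.sum_congr rfl fun i hi => Function.update_of_ne (fun h : i = c => hS (h ▸ hi)) _ _
    refine ⟨Function.update m c (f (insert c C) - f C), fun S hS => ?_, ?_⟩
    · by_cases hcS : c ∈ S
      · have hS' : S.erase c ⊆ C := fun i hi =>
          (Finset.mem_insert.1 (hS (Finset.mem_of_mem_erase hi))).resolve_left
            (Finset.ne_of_mem_erase hi)
        rw [← Finset.add_sum_erase _ _ hcS, hsum _ (Finset.notMem_erase c S),
          Function.update_self]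
        have h := hf S C
        have e1 : S ∪ C = insert c C := by
          ext a
          have := @hS a
          simp only [Finset.mem_union, Finset.mem_insert] at this ⊢
          constructor
          · tauto
          · rintro (rfl | h) <;> tauto
        have e2 : S ∩ C = S.erase c := by
          ext a
          have := @hS a
          simp only [Finset.mem_inter, Finset.mem_erase, Finset.mem_insert] at this ⊢
          constructor
          · rintro ⟨h3, h4⟩; exact ⟨fun h => hc (h ▸ h4), h3⟩
          · tauto
        rw [e1, e2] at h
        linarith [h1 _ hS']
      · rw [hsum _ hcS]
        exact h1 S fun i hi => (Finset.mem_insert.1 (hS hi)).resolve_left fun h => hcS (h ▸ hi)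
    · rw [Finset.sum_insert hc, hsum C hc, Function.update_self]
      linarith

/-- Sets not contained in C have weight zero at x, so the minorant is needed only on subsets of C.
-/
lemma multilinearExt_ge_modular {f : Finset X → ℝ} {C : Finset X} {a : ℝ} {m : X → ℝ}
    (hm : ∀ S ⊆ C, a + ∑ i ∈ S, m i ≤ f S) {x : X → ℝ} (hx : InBox x)
    (hxC : ∀ i ∉ C, x i = 0) : a + ∑ i, m i * x i ≤ multilinearExt f x := by
  rw [← multilinearExt_modular]
  refine multilinearExt_mono_of_weight hx fun S hS => hm S fun i hi => ?_
  by_contra hiC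
  refine hS (Finset.prod_eq_zero (Finset.mem_univ i) ?_)
  rw [if_pos hi, hxC i hiC]

end Multilinear

/-! ### From first order conditions to the approximation ratio -/

section Approximation

variable {X : Type*} [Fintype X] [DecidableEq X]

/-- Raising the coordinates in `C` to the common value `t`. -/
lemma multilinearExt_raise_ge {f : Finset X → ℝ} (hf0 : ∀ S, 0 ≤ f S) (hf : IsSubmodular f)
    {t : ℝ} (ht0 : 0 < t) (ht1 : t ≤ 1) {x : X → ℝ} (hx : ∀ i, 0 ≤ x i ∧ x i ≤ t)
    (C : Finset X) :
    (1 - t) * multilinearExt f x + (1 - t) * (t * f C -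
        (1 - t) * multilinearExt f (fun i => if i ∈ C then x i else 0)) ≤
      multilinearExt f (fun i => if i ∈ C then t else x i) := by
  have hxb : InBox x := fun i => ⟨(hx i).1, (hx i).2.trans ht1⟩
  have ht2 : 0 ≤ 1 - t := sub_nonneg.2 ht1
  set xC : X → ℝ := fun i => if i ∈ C then x i else 0 with hxC
  -- Solves (1-t) x + t q = t; that q ≤ 1 follows from x ≤ t ≤ 1.
  set q : X → ℝ := fun i => x i + (t - x i) / t with hq
  have hqb : ∀ i, x i ≤ q i ∧ q i ≤ 1 := fun i => by
    have h1 : 0 ≤ (t - x i) / t := div_nonneg (sub_nonneg.2 (hx i).2) ht0.le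
    have h2 : (t - x i) / t = 1 - x i / t := by field_simp
    have h3 : x i ≤ x i / t := by
      rw [le_div_iff₀ ht0]; nlinarith [(hx i).1]
    simp only [hq]
    constructor <;> linarith
  have hqe : ∀ i, (1 - t) * x i + t * q i = t := fun i => by
    simp only [hq]; field_simp; ring
  set p : X → ℝ := fun i => if i ∈ C then q i else x i with hp
  set pC : X → ℝ := fun i => if i ∈ C then q i else 0 with hpC
  have hpb : InBox p := fun i => by
    simp only [hp]; split_ifs
    · exact ⟨(hx i).1.trans (hqb i).1, (hqb i).2⟩
    · exact hxb i
  have hpCb : InBox pC := fun i => by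
    simp only [hpC]; split_ifs
    · exact ⟨(hx i).1.trans (hqb i).1, (hqb i).2⟩
    · simp
  have hxCb : InBox xC := fun i => by
    simp only [hxC]; split_ifs
    · exact hxb i
    · simp
  have h1 : (1 - t) * multilinearExt f x + t * multilinearExt f p ≤
      multilinearExt f (fun i => if i ∈ C then t else x i) := by
    refine multilinearExt_concave hf ht0.le ht1 hxb hpb (fun i => ?_) fun i => ?_
    · simp only [hp]; split_ifs
      · exact (hqb i).1
      · exact le_rfl
    · simp only [hp]; split_ifs
      · exact (hqe i).symm
      · ring
  have h2 : (1 - t) * multilinearExt f pC ≤ multilinearExt f p := by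
    -- Chosen so that p = (1-t) pC + t p1; nonnegativity of f discards the term of p1.
    set p1 : X → ℝ := fun i => if i ∈ C then q i else x i / t with hp1
    have hp1b : InBox p1 := fun i => by
      simp only [hp1]; split_ifs
      · exact ⟨(hx i).1.trans (hqb i).1, (hqb i).2⟩
      · exact ⟨div_nonneg (hx i).1 ht0.le, div_le_one_of_le₀ (hx i).2 ht0.le⟩
    have := multilinearExt_concave hf (u := p) ht0.le ht1 hpCb hp1b (fun i => by
      simp only [hpC, hp1]; split_ifs
      · exact le_rfl
      · exact div_nonneg (hx i).1 ht0.le) (fun i => by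
      simp only [hpC, hp1, hp]; split_ifs
      · ring
      · field_simp; ring)
    linarith [mul_nonneg ht0.le (multilinearExt_nonneg hf0 hp1b)]
  have h3 : t * f C ≤ (1 - t) * multilinearExt f xC + t * multilinearExt f pC := by
    -- Since (1-t) xC + t pC = t 1_C, averaging the minorant leaves f(∅) + t (f(C) - f(∅)) ≥ t f(C).
    obtain ⟨m, hm1, hm2⟩ := exists_modular_minorant hf C
    have a1 := multilinearExt_ge_modular hm1 hxCb (fun i hi => by simp [hxC, hi])
    have a2 := multilinearExt_ge_modular hm1 hpCb (fun i hi => by simp [hpC, hi])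
    have e : (1 - t) * ∑ i, m i * xC i + t * ∑ i, m i * pC i = t * ∑ i ∈ C, m i := by
      rw [Finset.mul_sum, Finset.mul_sum, Finset.mul_sum, ← Finset.sum_add_distrib,
        ← Finset.sum_subset (Finset.subset_univ C)]
      · refine Finset.sum_congr rfl fun i hi => ?_
        simp only [hxC, hpC, if_pos hi]
        linear_combination m i * hqe i
      · intro i _ hi
        simp [hxC, hpC, hi]
    have b1 := mul_le_mul_of_nonneg_left a1 ht2
    have b2 := mul_le_mul_of_nonneg_left a2 ht0.le
    have b3 : t * f C = t * f ∅ + t * ∑ i ∈ C, m i := by rw [← hm2]; ring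
    have b4 := mul_nonneg ht2 (hf0 ∅)
    linarith
  have h4 := mul_le_mul_of_nonneg_left h2 ht0.le
  have h5 := mul_le_mul_of_nonneg_left h3 ht2
  linarith

/-- If the point `x ≤ t` satisfies the first order condition towards `t 1_C + (1 - t) x_{X ∖ C}`
and no coordinate in its support should be decreased, then `F(x) ≥ (t - t²/2) f(C)`. -/
lemma multilinearExt_ge_of_first_order {f : Finset X → ℝ} (hf0 : ∀ S, 0 ≤ f S)
    (hf : IsSubmodular f) {t : ℝ} (ht : t ∈ Set.Icc (0 : ℝ) ((3 - Real.sqrt 5) / 2))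
    {x : X → ℝ} (hx : ∀ i, 0 ≤ x i ∧ x i ≤ t) (C : Finset X)
    (hsupp : ∀ i, 0 < x i → 0 ≤ pd f i x)
    (hz : ∑ i, pd f i x * ((if i ∈ C then t else (1 - t) * x i) - x i) ≤ 0) :
    (t - t ^ 2 / 2) * f C ≤ multilinearExt f x := by
  obtain ⟨ht0, hts⟩ := ht
  have hs5 : (2 : ℝ) ≤ Real.sqrt 5 := Real.le_sqrt_of_sq_le (by norm_num)
  have hs : Real.sqrt 5 ^ 2 = 5 := Real.sq_sqrt (by norm_num)
  have ht1 : t ≤ 1 / 2 := by linarith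
  -- The upper end of the range of t is the smaller root of 1 - 3t + t².
  have hquad : 0 ≤ 1 - 3 * t + t ^ 2 := by
    nlinarith [mul_nonneg (sub_nonneg.2 hts) (show 0 ≤ (3 + Real.sqrt 5) / 2 - t by linarith)]
  have hxb : InBox x := fun i => ⟨(hx i).1, by linarith [(hx i).2]⟩
  rcases ht0.eq_or_lt with rfl | htpos
  · simpa using multilinearExt_nonneg hf0 hxb
  set xC : X → ℝ := fun i => if i ∈ C then x i else 0 with hxC
  set u : X → ℝ := fun i => if i ∈ C then t else x i with hu
  have hxCb : InBox xC := fun i => by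
    simp only [hxC]; split_ifs
    · exact hxb i
    · simp
  have hub : InBox u := fun i => by
    simp only [hu]; split_ifs
    · exact ⟨ht0, by linarith⟩
    · exact hxb i
  have h1 := (multilinearExt_sub_bounds hf hxb hub (fun i => by
    simp only [hu]; split_ifs
    · exact (hx i).2
    · exact le_rfl)).1
  have h2 := (multilinearExt_sub_bounds hf hxCb hxb (fun i => by
    simp only [hxC]; split_ifs
    · exact le_rfl
    · exact (hx i).1)).2
  have hpos : 0 ≤ ∑ i, (x i - xC i) * pd f i x := Finset.sum_nonneg fun i _ => by
    simp only [hxC]; split_ifs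
    · simp
    · rw [sub_zero]
      rcases (hx i).1.eq_or_lt with h | h
      · rw [← h]; simp
      · exact mul_nonneg h.le (hsupp i h)
  -- Splits the test direction into raising C to t, minus t times the part of x off C. With `h1` and
  -- `h2` this gives F(u) - F(x) ≤ t (F(x) - F(xC)).
  have e : ∑ i, pd f i x * ((if i ∈ C then t else (1 - t) * x i) - x i) =
      ∑ i, (u i - x i) * pd f i x - t * ∑ i, (x i - xC i) * pd f i x := by
    rw [Finset.mul_sum, ← Finset.sum_sub_distrib]
    refine Finset.sum_congr rfl fun i _ => ?_
    simp only [hu, hxC]; split_ifs <;> ring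
  have h3 := multilinearExt_raise_ge hf0 hf htpos (by linarith) hx C
  have h4 := multilinearExt_nonneg hf0 hxb
  have h5 := hf0 C
  have h6 := mul_le_mul_of_nonneg_left h2 ht0
  set F := multilinearExt f x
  set FC := multilinearExt f xC
  have h7 : FC ≤ F := by linarith
  have h8 : t * (1 - t) * f C ≤ 2 * t * F + (1 - 3 * t + t ^ 2) * FC := by
    change (1 - t) * F + (1 - t) * (t * f C - (1 - t) * FC) ≤ multilinearExt f u at h3
    linarith
  have h9 : t * (1 - t) * f C ≤ (1 - t + t ^ 2) * F := by
    linarith [mul_le_mul_of_nonneg_left h7 hquad]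
  -- The difference t(1-t) - (1-t+t²)(t-t²/2) equals (t²/2)(1-3t+t²).
  have h10 : 0 < 1 - t + t ^ 2 := by nlinarith
  have h11 : (1 - t + t ^ 2) * ((t - t ^ 2 / 2) * f C) ≤ t * (1 - t) * f C := by
    have : 0 ≤ t ^ 2 / 2 * (1 - 3 * t + t ^ 2) * f C := by positivity
    nlinarith
  exact le_of_mul_le_mul_left (h11.trans h9) h10

end Approximation

/-! ### Greedy algorithm and rank descriptions of the matroid polytopes -/

section Polytope

variable {X : Type*} [Fintype X] [DecidableEq X]

/-- Abel summation: nonnegative sums over all upper level sets of `w` at positive levels. -/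
lemma sum_posPart_mul_nonneg (d : X → ℝ) (w : X → ℝ)
    (h : ∀ θ > 0, 0 ≤ ∑ i ∈ Finset.univ.filter (fun i => θ ≤ w i), d i) :
    0 ≤ ∑ i ∈ Finset.univ.filter (fun i => 0 < w i), w i * d i := by
  induction hn : (Finset.univ.filter (fun i => 0 < w i)).card using Nat.strong_induction_on
    generalizing w with
  | _ n ih =>
    rcases (Finset.univ.filter (fun i => 0 < w i)).eq_empty_or_nonempty with he | hne
    · simp [he]
    · obtain ⟨k, hk, hmin⟩ := Finset.exists_min_image _ w hne
      have hk0 : 0 < w k := (Finset.mem_filter.1 hk).2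
      have hmin' : ∀ i, 0 < w i → w k ≤ w i := fun i hi => hmin i (by simpa using hi)
      have hsub : Finset.univ.filter (fun i => 0 < w i - w k) ⊆
          Finset.univ.filter (fun i => 0 < w i) := fun i hi => by
        simp only [Finset.mem_filter, Finset.mem_univ, true_and] at hi ⊢; linarith
      have hlt : (Finset.univ.filter (fun i => 0 < w i - w k)).card < n := by
        rw [← hn]
        refine Finset.card_lt_card ⟨hsub, fun hs => ?_⟩
        have := hs hk
        simp at this
      -- Lowering w by its smallest positive value shifts the levels and removes at least k from the
      -- positive support.
      have h1 := ih _ hlt (fun i => w i - w k) (fun θ hθ => by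
        have := h (θ + w k) (by linarith)
        simpa only [le_sub_iff_add_le] using this) rfl
      have h2 : 0 ≤ ∑ i ∈ Finset.univ.filter (fun i => 0 < w i), d i := by
        have := h (w k) hk0
        convert this using 2
        ext i
        simp only [Finset.mem_filter, Finset.mem_univ, true_and]
        exact ⟨hmin' i, fun h => hk0.trans_le h⟩
      have h3 : ∑ i ∈ Finset.univ.filter (fun i => 0 < w i), w i * d i =
          ∑ i ∈ Finset.univ.filter (fun i => 0 < w i - w k), (w i - w k) * d i +
            w k * ∑ i ∈ Finset.univ.filter (fun i => 0 < w i), d i := by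
        rw [Finset.sum_subset hsub, Finset.mul_sum, ← Finset.sum_add_distrib]
        · exact Finset.sum_congr rfl fun i _ => by ring
        · intro i hi hi'
          simp only [Finset.mem_filter, Finset.mem_univ, true_and] at hi hi'
          have : w i - w k = 0 := le_antisymm (not_lt.1 hi') (by linarith [hmin' i hi])
          rw [this, zero_mul]
      rw [h3]
      exact add_nonneg h1 (mul_nonneg hk0.le h2)

lemma eRk_ne_top (N : Matroid X) (A : Finset X) : N.eRk (A : Set X) ≠ ⊤ :=
  ((N.eRk_le_encard _).trans_lt (A.finite_toSet.encard_lt_top)).ne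

lemma coe_toNat_eRk (N : Matroid X) (A : Finset X) :
    (((N.eRk (A : Set X)).toNat : ℕ) : ℕ∞) = N.eRk (A : Set X) :=
  ENat.natCast_toNat (eRk_ne_top N A)

lemma rank_nonneg (N : Matroid X) (A : Finset X) : 0 ≤ rank N A := Nat.cast_nonneg _

lemma rank_le_card (N : Matroid X) (A : Finset X) : rank N A ≤ A.card := by
  unfold rank
  refine Nat.cast_le.2 (ENat.toNat_le_of_le_natCast ?_)
  rw [← Set.encard_coe_eq_coe_finsetCard]
  exact N.eRk_le_encard _

lemma rank_empty (N : Matroid X) : rank N ∅ = 0 := by simp [rank]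

lemma rank_submod (N : Matroid X) (A B : Finset X) :
    rank N (A ∪ B) + rank N (A ∩ B) ≤ rank N A + rank N B := by
  have h := N.eRk_inter_add_eRk_union_le (A : Set X) (B : Set X)
  rw [← Finset.coe_inter, ← Finset.coe_union, ← coe_toNat_eRk N (A ∩ B),
    ← coe_toNat_eRk N (A ∪ B), ← coe_toNat_eRk N A, ← coe_toNat_eRk N B] at h
  have h' : (N.eRk ((A ∩ B : Finset X) : Set X)).toNat +
      (N.eRk ((A ∪ B : Finset X) : Set X)).toNat ≤
      (N.eRk (A : Set X)).toNat + (N.eRk (B : Set X)).toNat := by exact_mod_cast h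
  unfold rank
  have := (Nat.cast_le (α := ℝ)).2 h'
  rw [Nat.cast_add, Nat.cast_add] at this
  linarith

lemma rank_congr (N : Matroid X) {A B : Finset X} (h : (A : Set X) ∩ N.E = (B : Set X) ∩ N.E) :
    rank N A = rank N B := by
  unfold rank
  rw [← N.eRk_inter_ground, h, N.eRk_inter_ground]

lemma rank_eq_univ (N : Matroid X) {A : Finset X} (h : N.E ⊆ A) :
    rank N A = rank N Finset.univ :=
  rank_congr N (by simp [Set.inter_eq_right.2 h])

lemma rank_singleton_of_notMem (N : Matroid X) {i : X} (h : i ∉ N.E) : rank N {i} = 0 := by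
  rw [← rank_empty N]
  exact rank_congr N (by simp [h])

lemma rank_delete (N : Matroid X) (i : X) (A : Finset X) :
    rank (N.delete {i}) A = rank N (A.erase i) := by
  unfold rank
  rw [Matroid.delete_eq_restrict, Matroid.restrict_eRk_eq', Finset.coe_erase,
    ← N.eRk_inter_ground ((A : Set X) \ {i})]
  congr 3
  ext a; simp; tauto

lemma card_inter_le_rank {N : Matroid X} {I : Finset X} (hI : N.Indep (I : Set X))
    (A : Finset X) : ((I ∩ A).card : ℝ) ≤ rank N A := by
  refine Nat.cast_le.2 ?_
  have h : ((I ∩ A : Finset X) : Set X).encard ≤ N.eRk (A : Set X) :=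
    (hI.subset (by simp)).encard_le_eRk_of_subset (by simp)
  rw [← coe_toNat_eRk, Set.encard_coe_eq_coe_finsetCard] at h
  exact_mod_cast h

lemma indep_of_card_le_rank {N : Matroid X} {I : Finset X} (h : (I.card : ℝ) ≤ rank N I) :
    N.Indep (I : Set X) := by
  refine (N.isRkFinite_of_finite I.finite_toSet).indep_of_encard_le_eRk ?_
  rw [← coe_toNat_eRk, Set.encard_coe_eq_coe_finsetCard]
  unfold rank at h
  exact_mod_cast h

/-- The greedy algorithm: some base meets every upper level set of `w` in a basis of it. -/
lemma exists_greedy_base (N : Matroid X) (w : X → ℝ) :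
    ∃ B : Finset X, N.IsBase (B : Set X) ∧
      ∀ θ, ((B ∩ Finset.univ.filter (fun i => θ ≤ w i)).card : ℝ) =
        rank N (Finset.univ.filter (fun i => θ ≤ w i)) := by
  have key : ∀ Θ : Finset ℝ, ∃ I : Finset X, N.Indep (I : Set X) ∧
      (∀ i ∈ I, ∃ θ ∈ Θ, θ ≤ w i) ∧
      ∀ θ ∈ Θ, ((I ∩ Finset.univ.filter (fun i => θ ≤ w i)).card : ℝ) =
        rank N (Finset.univ.filter (fun i => θ ≤ w i)) := by
    intro Θ
    -- Thresholds enter from the highest down, so the set built so far lies in the new level set and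
    -- extends to a basis of it.
    induction Θ using Finset.induction_on_min with
    | empty => exact ⟨∅, by simp⟩
    | insert θ₀ Θ hlt ih =>
      obtain ⟨I, hI, hIΘ, hIr⟩ := ih
      set L := Finset.univ.filter (fun i => θ₀ ≤ w i) with hL
      have hIL : (I : Set X) ⊆ L := fun i hi => by
        obtain ⟨θ, hθ, hθi⟩ := hIΘ i hi
        simpa [hL] using (hlt θ hθ).le.trans hθi
      obtain ⟨J, hJ, hIJ⟩ := hI.subset_isBasis'_of_subset hIL
      have hJr : (J.toFinite.toFinset.card : ℝ) = rank N L := by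
        unfold rank
        rw [hJ.eRk_eq_encard, Set.Finite.encard_eq_coe_toFinset_card J.toFinite]
        simp
      refine ⟨J.toFinite.toFinset, by simpa using hJ.indep, fun i hi => ⟨θ₀, by simp, ?_⟩, ?_⟩
      · have := hJ.subset ((Set.Finite.mem_toFinset _).1 hi)
        simpa [hL] using this
      · intro θ hθ
        rcases Finset.mem_insert.1 hθ with rfl | hθ
        · rw [← hJr]
          congr 2
          refine Finset.inter_eq_left.2 fun i hi => ?_
          have := hJ.subset ((Set.Finite.mem_toFinset _).1 hi)
          simpa [hL] using this
        · refine le_antisymm (card_inter_le_rank (by simpa using hJ.indep) _) ?_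
          rw [← hIr θ hθ]
          refine Nat.cast_le.2 (Finset.card_le_card (Finset.inter_subset_inter_right ?_))
          intro i hi
          simpa using hIJ hi
  obtain ⟨I, hI, -, hIr⟩ := key (Finset.univ.image w)
  obtain ⟨B, hB, hIB⟩ := hI.exists_isBase_superset
  refine ⟨B.toFinite.toFinset, by simpa using hB, fun θ => ?_⟩
  -- Level sets change only at values of w, so θ may be replaced by the smallest value of w that is
  -- at least θ.
  rcases (Finset.univ.filter (fun i => θ ≤ w i)).eq_empty_or_nonempty with he | hne
  · rw [he]; simp [rank_empty]
  · obtain ⟨k, hk, hmin⟩ := Finset.exists_min_image _ w hne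
    have e : Finset.univ.filter (fun i => θ ≤ w i) = Finset.univ.filter (fun i => w k ≤ w i) := by
      ext i
      simp only [Finset.mem_filter, Finset.mem_univ, true_and] at hk ⊢
      exact ⟨fun h => hmin i (by simpa using h), fun h => hk.trans h⟩
    rw [e]
    refine le_antisymm (card_inter_le_rank (by simpa using hB.indep) _) ?_
    rw [← hIr (w k) (by simp)]
    refine Nat.cast_le.2 (Finset.card_le_card (Finset.inter_subset_inter_right ?_))
    intro i hi
    simpa using hIB hi

/-- The matroid polytope described by its rank inequalities. -/
def RankPolytope (N : Matroid X) (x : X → ℝ) : Prop :=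
  (∀ i, 0 ≤ x i) ∧ ∀ A : Finset X, ∑ a ∈ A, x a ≤ rank N A

lemma charVec_coe_apply (I : Finset X) (i : X) :
    charVec (I : Set X) i = if i ∈ I then 1 else 0 := by
  simp [charVec, Set.indicator_apply]

lemma sum_charVec (I A : Finset X) : ∑ a ∈ A, charVec (I : Set X) a = (I ∩ A).card := by
  simp only [charVec_coe_apply, Finset.sum_ite_mem, Finset.sum_const, nsmul_eq_mul, mul_one]
  rw [Finset.inter_comm]

lemma exists_finset_coe (I : Set X) : ∃ J : Finset X, (J : Set X) = I :=
  ⟨I.toFinite.toFinset, by simp⟩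

lemma convex_rankPolytope (N : Matroid X) : Convex ℝ {x | RankPolytope N x} := by
  intro x hx y hy a b ha hb hab
  refine ⟨fun i => ?_, fun A => ?_⟩
  · simp only [Pi.add_apply, Pi.smul_apply, smul_eq_mul]
    exact add_nonneg (mul_nonneg ha (hx.1 i)) (mul_nonneg hb (hy.1 i))
  · simp only [Pi.add_apply, Pi.smul_apply, smul_eq_mul, Finset.sum_add_distrib,
      ← Finset.mul_sum]
    have h1 := mul_le_mul_of_nonneg_left (hx.2 A) ha
    have h2 := mul_le_mul_of_nonneg_left (hy.2 A) hb
    calc _ ≤ a * rank N A + b * rank N A := add_le_add h1 h2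
      _ = rank N A := by rw [← add_mul, hab, one_mul]

lemma rankPolytope_charVec {N : Matroid X} {I : Set X} (hI : N.Indep I) :
    RankPolytope N (charVec I) := by
  obtain ⟨I, rfl⟩ := exists_finset_coe I
  refine ⟨fun i => ?_, fun A => ?_⟩
  · rw [charVec_coe_apply]; split_ifs <;> norm_num
  · rw [sum_charVec]; exact card_inter_le_rank hI A

lemma exists_weight_of_notMem_convexHull {s : Set (X → ℝ)} (hs : s.Finite) {x : X → ℝ}
    (hx : x ∉ convexHull ℝ s) : ∃ w : X → ℝ, ∀ v ∈ s, ∑ i, w i * v i < ∑ i, w i * x i := by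
  obtain ⟨φ, u, h1, h2⟩ := geometric_hahn_banach_closed_point (convex_convexHull ℝ s)
    (hs.isClosed_convexHull ℝ) hx
  have e : ∀ v, φ v = ∑ i, φ (Pi.single i 1) * v i := fun v => by
    have := LinearMap.pi_apply_eq_sum_univ (φ : (X → ℝ) →ₗ[ℝ] ℝ) v
    rw [ContinuousLinearMap.coe_coe] at this
    rw [this]
    refine Finset.sum_congr rfl fun i _ => ?_
    rw [smul_eq_mul, mul_comm]
    congr 2
    ext j
    simp [Pi.single_apply, eq_comm]
  refine ⟨fun i => φ (Pi.single i 1), fun v hv => ?_⟩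
  rw [← e, ← e]
  exact (h1 v (subset_convexHull ℝ s hv)).trans h2

/-- On each level set B attains the rank, which bounds the mass of x there; summing over levels
compares the weights. -/
lemma sum_mul_le_of_greedy {N : Matroid X} {x : X → ℝ} (hx : RankPolytope N x) (w : X → ℝ)
    {B : Finset X} (hB : ∀ θ, ((B ∩ Finset.univ.filter (fun i => θ ≤ w i)).card : ℝ) =
        rank N (Finset.univ.filter (fun i => θ ≤ w i))) :
    ∑ i ∈ Finset.univ.filter (fun i => 0 < w i), w i * x i ≤
      ∑ i ∈ Finset.univ.filter (fun i => 0 < w i), w i * charVec (B : Set X) i := by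
  have := sum_posPart_mul_nonneg (fun i => charVec (B : Set X) i - x i) w (fun θ _ => by
    rw [Finset.sum_sub_distrib, sum_charVec, hB, sub_nonneg]
    exact hx.2 _)
  simp only [mul_sub, Finset.sum_sub_distrib, sub_nonneg] at this
  exact this

/-- Edmonds: the matroid polytope is given by the rank inequalities. -/
theorem mem_polytope_iff {N : Matroid X} {x : X → ℝ} : x ∈ polytope N ↔ RankPolytope N x := by
  constructor
  · intro h
    refine convexHull_min ?_ (convex_rankPolytope N) h
    rintro _ ⟨I, hI, rfl⟩
    exact rankPolytope_charVec hI
  · intro hx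
    by_contra hx'
    obtain ⟨w, hw⟩ := exists_weight_of_notMem_convexHull
      ((Set.finite_range (fun I : Set X => (charVec I : X → ℝ))).subset
        (by rintro _ ⟨I, -, rfl⟩; exact ⟨I, rfl⟩)) hx'
    obtain ⟨B, hB, hBr⟩ := exists_greedy_base N w
    have h1 := sum_mul_le_of_greedy hx w hBr
    -- Elements of nonpositive weight are dropped from the base; the rest is still independent.
    have h2 := hw (charVec ((B ∩ Finset.univ.filter (fun i => 0 < w i) : Finset X) : Set X))
      ⟨_, hB.indep.subset (by simp), rfl⟩
    have h3 : ∑ i, w i * charVec ((B ∩ Finset.univ.filter (fun i => 0 < w i) : Finset X) : Set X) i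
        = ∑ i ∈ Finset.univ.filter (fun i => 0 < w i), w i * charVec (B : Set X) i := by
      rw [Finset.sum_filter]
      refine Finset.sum_congr rfl fun i _ => ?_
      simp only [charVec_coe_apply, Finset.mem_inter, Finset.mem_filter, Finset.mem_univ, true_and]
      by_cases h : 0 < w i <;> simp [h]
    have h4 : ∑ i, w i * x i ≤ ∑ i ∈ Finset.univ.filter (fun i => 0 < w i), w i * x i := by
      rw [Finset.sum_filter]
      refine Finset.sum_le_sum fun i _ => ?_
      split_ifs with h
      · exact le_rfl
      · exact mul_nonpos_of_nonpos_of_nonneg (not_lt.1 h) (hx.1 i)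
    linarith

/-- The base polytope is the face of the matroid polytope of the points of maximal size. -/
theorem mem_basePolytope_iff {N : Matroid X} {x : X → ℝ} :
    x ∈ basePolytope N ↔ RankPolytope N x ∧ ∑ i, x i = rank N Finset.univ := by
  have hcard : ∀ B : Finset X, N.IsBase (B : Set X) → (B.card : ℝ) = rank N Finset.univ := by
    intro B hB
    rw [← rank_eq_univ N (A := N.E.toFinite.toFinset) (by simp)]
    unfold rank
    rw [Set.Finite.coe_toFinset, N.eRk_ground, ← hB.encard_eq_eRank,
      Set.encard_coe_eq_coe_finsetCard]
    simp
  constructor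
  · intro h
    have hconv : Convex ℝ {y : X → ℝ | ∑ i, y i = rank N Finset.univ} := by
      intro y hy z hz a b _ _ hab
      simp only [Set.mem_ofPred_eq] at hy hz ⊢
      simp only [Pi.add_apply, Pi.smul_apply, smul_eq_mul, Finset.sum_add_distrib,
        ← Finset.mul_sum, hy, hz]
      rw [← add_mul, hab, one_mul]
    refine convexHull_min ?_ ((convex_rankPolytope N).inter hconv) h
    rintro _ ⟨B, hB, rfl⟩
    refine ⟨rankPolytope_charVec hB.indep, ?_⟩
    obtain ⟨B, rfl⟩ := exists_finset_coe B
    simp only [Set.mem_ofPred_eq]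
    rw [sum_charVec, Finset.inter_univ, hcard B hB]
  · rintro ⟨hx, hxr⟩
    by_contra hx'
    obtain ⟨w, hw⟩ := exists_weight_of_notMem_convexHull
      ((Set.finite_range (fun I : Set X => (charVec I : X → ℝ))).subset
        (by rintro _ ⟨I, -, rfl⟩; exact ⟨I, rfl⟩)) hx'
    -- A base cannot drop elements, so the weights are shifted to be positive; x and B have equal
    -- total mass, and the shift cancels.
    set c := 1 + ∑ i, |w i| with hc
    have hpos : ∀ i, 0 < w i + c := fun i => by
      have h1 := Finset.single_le_sum (f := fun i => |w i|) (fun _ _ => abs_nonneg _)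
        (Finset.mem_univ i)
      have h2 := neg_abs_le (w i)
      linarith
    obtain ⟨B, hB, hBr⟩ := exists_greedy_base N (fun i => w i + c)
    have h1 := sum_mul_le_of_greedy hx _ hBr
    have huniv : Finset.univ.filter (fun i => 0 < w i + c) = Finset.univ :=
      Finset.filter_true_of_mem fun i _ => hpos i
    rw [huniv] at h1
    simp only [add_mul, Finset.sum_add_distrib, ← Finset.mul_sum] at h1
    rw [sum_charVec, Finset.inter_univ, hcard B hB, hxr] at h1
    have h2 := hw _ ⟨_, hB, rfl⟩
    linarith

end Polytope

/-! ### Tight sets and local optima on the 1/q grid -/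

section LocalOptimum

variable {X : Type*} [Fintype X] [DecidableEq X]

/-- The rank inequality of `A` holds with equality at `x`. -/
def Tight (N : Matroid X) (x : X → ℝ) (A : Finset X) : Prop := ∑ a ∈ A, x a = rank N A

/-- Uncrossing: the rank is submodular and the mass of x is modular, so neither inequality can be
strict. -/
lemma Tight.union_inter {N : Matroid X} {x : X → ℝ} (hx : RankPolytope N x) {A B : Finset X}
    (hA : Tight N x A) (hB : Tight N x B) : Tight N x (A ∪ B) ∧ Tight N x (A ∩ B) := by
  unfold Tight at *
  have h1 := Finset.sum_union_inter (s₁ := A) (s₂ := B) (f := x)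
  have h2 := rank_submod N A B
  have h3 := hx.2 (A ∪ B)
  have h4 := hx.2 (A ∩ B)
  constructor <;> linarith

lemma tight_empty (N : Matroid X) (x : X → ℝ) : Tight N x ∅ := by
  simp [Tight, rank_empty]

lemma tight_biUnion {N : Matroid X} {x : X → ℝ} (hx : RankPolytope N x) (s : Finset X)
    (D : X → Finset X) (hD : ∀ i ∈ s, Tight N x (D i)) : Tight N x (s.biUnion D) := by
  induction s using Finset.induction_on with
  | empty => simpa using tight_empty N x
  | insert i s hi ih =>
    rw [Finset.biUnion_insert]
    exact ((hD i (by simp)).union_inter hx (ih fun j hj => hD j (by simp [hj]))).1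

lemma sum_add_smul_stdVec (x : X → ℝ) (i : X) (s : ℝ) (A : Finset X) :
    ∑ a ∈ A, (x + s • stdVec i) a = ∑ a ∈ A, x a + if i ∈ A then s else 0 := by
  simp [stdVec, Finset.sum_add_distrib, Pi.single_apply]

lemma sum_add_smul_stdVec_sub (x : X → ℝ) (i j : X) (s : ℝ) (A : Finset X) :
    ∑ a ∈ A, (x + s • (stdVec i - stdVec j)) a =
      ∑ a ∈ A, x a + s * ((if i ∈ A then 1 else 0) - if j ∈ A then 1 else 0) := by
  simp only [Pi.add_apply, Pi.smul_apply, Pi.sub_apply, stdVec, smul_eq_mul, Finset.sum_add_distrib,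
    ← Finset.mul_sum, Finset.sum_sub_distrib, Pi.single_apply, Finset.sum_ite_eq']

lemma add_smul_stdVec_eq_update (x : X → ℝ) (i : X) (s : ℝ) :
    x + s • stdVec i = Function.update x i (x i + s) := by
  ext a
  by_cases h : a = i
  · subst h; simp [stdVec]
  · simp [stdVec, h]

lemma multilinearExt_add_smul_stdVec (f : Finset X → ℝ) (x : X → ℝ) (i : X) (s : ℝ) :
    multilinearExt f (x + s • stdVec i) = multilinearExt f x + s * pd f i x := by
  rw [add_smul_stdVec_eq_update, multilinearExt_update_eq]
  ring

lemma RankPolytope.le_one {N : Matroid X} {x : X → ℝ} (hx : RankPolytope N x) (i : X) :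
    x i ≤ 1 := by
  have h1 := hx.2 {i}
  have h2 := rank_le_card N {i}
  simp only [Finset.sum_singleton, Finset.card_singleton, Nat.cast_one] at h1 h2
  linarith

lemma RankPolytope.inBox {N : Matroid X} {x : X → ℝ} (hx : RankPolytope N x) : InBox x :=
  fun i => ⟨hx.1 i, hx.le_one i⟩

lemma RankPolytope.mono {N : Matroid X} {x y : X → ℝ} (hx : RankPolytope N x)
    (hy : ∀ i, 0 ≤ y i) (hyx : y ≤ x) : RankPolytope N y :=
  ⟨hy, fun A => (Finset.sum_le_sum fun i _ => hyx i).trans (hx.2 A)⟩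

lemma RankPolytope.add_smul_stdVec {N : Matroid X} {x : X → ℝ} (hx : RankPolytope N x) {i : X}
    {s : ℝ} (hs : 0 ≤ x i + s) (h : ∀ A : Finset X, i ∈ A → ∑ a ∈ A, x a + s ≤ rank N A) :
    RankPolytope N (x + s • stdVec i) := by
  refine ⟨fun a => ?_, fun A => ?_⟩
  · rw [add_smul_stdVec_eq_update]
    by_cases ha : a = i
    · subst ha; simpa using hs
    · simpa [ha] using hx.1 a
  · rw [sum_add_smul_stdVec]
    split_ifs with hi
    · exact h A hi
    · simpa using hx.2 A

/-- Only sets with i but without j gain mass in the exchange. -/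
lemma RankPolytope.exchange {N : Matroid X} {x : X → ℝ} (hx : RankPolytope N x) {i j : X}
    (hij : i ≠ j) {s : ℝ} (hs0 : 0 ≤ s) (hs : s ≤ x j)
    (h : ∀ A : Finset X, i ∈ A → j ∉ A → ∑ a ∈ A, x a + s ≤ rank N A) :
    RankPolytope N (x + s • (stdVec i - stdVec j)) := by
  refine ⟨fun a => ?_, fun A => ?_⟩
  · rw [add_smul_stdVec_sub x hij]
    by_cases ha : a = j
    · subst ha; simpa using hs
    · by_cases hb : a = i
      · subst hb; simpa [ha] using add_nonneg (hx.1 a) hs0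
      · simpa [ha, hb] using hx.1 a
  · rw [sum_add_smul_stdVec_sub]
    have := hx.2 A
    by_cases hi : i ∈ A <;> by_cases hj : j ∈ A
    · simpa [hi, hj] using this
    · simpa [hi, hj] using h A hi hj
    · simp only [hi, hj, if_true, if_false]; linarith
    · simpa [hi, hj] using this

/-- Multiples of `1/q`. -/
def IsMultiple (q : ℕ) (a : ℝ) : Prop := ∃ k : ℤ, a = k / q

lemma IsMultiple.add {q : ℕ} {a b : ℝ} (ha : IsMultiple q a) (hb : IsMultiple q b) :
    IsMultiple q (a + b) := by
  obtain ⟨k, rfl⟩ := ha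
  obtain ⟨l, rfl⟩ := hb
  exact ⟨k + l, by push_cast; ring⟩

lemma isMultiple_zero (q : ℕ) : IsMultiple q 0 := ⟨0, by simp⟩

lemma isMultiple_sum {q : ℕ} {x : X → ℝ} {A : Finset X} (hx : ∀ i ∈ A, IsMultiple q (x i)) :
    IsMultiple q (∑ a ∈ A, x a) := by
  induction A using Finset.induction_on with
  | empty => simpa using isMultiple_zero q
  | insert i A hi ih =>
    rw [Finset.sum_insert hi]
    exact (hx i (by simp)).add (ih fun j hj => hx j (by simp [hj]))

lemma isMultiple_rank {q : ℕ} (hq : 0 < q) (N : Matroid X) (A : Finset X) :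
    IsMultiple q (rank N A) := by
  refine ⟨(N.eRk (A : Set X)).toNat * q, ?_⟩
  unfold rank
  push_cast
  field_simp

/-- This makes step length 1/q sufficient: a constraint on the grid that is not tight has slack for
a whole step. -/
lemma IsMultiple.add_le_of_lt {q : ℕ} (hq : 0 < q) {a b : ℝ} (ha : IsMultiple q a)
    (hb : IsMultiple q b) (h : a < b) : a + 1 / q ≤ b := by
  obtain ⟨k, rfl⟩ := ha
  obtain ⟨l, rfl⟩ := hb
  have hq' : (0 : ℝ) < q := Nat.cast_pos.2 hq
  rw [div_lt_div_iff_of_pos_right hq'] at h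
  rw [← add_div, div_le_div_iff_of_pos_right hq']
  exact_mod_cast h

lemma mem_boxedPolytope_iff {N : Matroid X} {t : ℝ} {x : X → ℝ} :
    x ∈ boxedPolytope N t ↔ RankPolytope N x ∧ ∀ i, x i ≤ t := by
  unfold boxedPolytope
  rw [Set.mem_inter_iff, mem_polytope_iff]
  exact ⟨fun h => ⟨h.1, fun i => (h.2 i).2⟩, fun h => ⟨h.1, fun i => ⟨h.1.1 i, h.2 i⟩⟩⟩

/-- The first order conditions at a local optimum of the search with step length `1/q`: the
gradient is maximized over `P_t(M)` at the local optimum. -/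
lemma localOpt_first_order {M : Matroid X} {f : Finset X → ℝ} (hf : IsSubmodular f) {q : ℕ}
    (hq : 0 < q) {t : ℝ} (ht : IsMultiple q t) {x : X → ℝ} (hxq : ∀ i, IsMultiple q (x i))
    (hx : x ∈ boxedPolytope M t) (hopt : ¬ ∃ x', Improves M f t (1 / (q : ℝ)) x x') :
    (∀ i, 0 < x i → 0 ≤ pd f i x) ∧
      ∀ z, RankPolytope M z → (∀ i, z i ≤ t) → ∑ i, pd f i x * (z i - x i) ≤ 0 := by
  classical
  have hδ : (0 : ℝ) < 1 / q := by positivity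
  rw [mem_boxedPolytope_iff] at hx
  obtain ⟨hxr, hxt⟩ := hx
  have hstep : ∀ i j : X, ∀ v ∈ ({stdVec j, -stdVec i, stdVec j - stdVec i} : Set (X → ℝ)),
      RankPolytope M (x + (1 / (q : ℝ)) • v) → (∀ a, (x + (1 / (q : ℝ)) • v) a ≤ t) →
      multilinearExt f (x + (1 / (q : ℝ)) • v) ≤ multilinearExt f x := by
    intro i j v hv h1 h2
    by_contra! h
    exact hopt ⟨_, i, j, v, hv, rfl, mem_boxedPolytope_iff.2 ⟨h1, h2⟩, h⟩
  have hdown : ∀ i, 0 < x i → 0 ≤ pd f i x := by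
    intro i hi
    have hi' := (isMultiple_zero q).add_le_of_lt hq (hxq i) hi
    have e : x + (1 / (q : ℝ)) • (-stdVec i) = x + (-(1 / (q : ℝ))) • stdVec i := by simp
    have hle : x + (-(1 / (q : ℝ))) • stdVec i ≤ x := by
      rw [add_smul_stdVec_eq_update]
      exact update_le_iff.2 ⟨by linarith, fun _ _ => le_rfl⟩
    have h := hstep i i (-stdVec i) (by simp) (by
      rw [e]
      exact hxr.add_smul_stdVec (by linarith) fun A _ => by linarith [hxr.2 A])
      (fun a => by rw [e]; exact (hle a).trans (hxt a))
    rw [e, multilinearExt_add_smul_stdVec] at h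
    nlinarith
  have hup : ∀ j, x j < t → (∀ A, j ∈ A → ¬ Tight M x A) → pd f j x ≤ 0 := by
    intro j hj hA
    have hj' := (hxq j).add_le_of_lt hq ht hj
    have h := hstep j j _ (by simp) (hxr.add_smul_stdVec (by linarith [hxr.1 j]) fun A hjA =>
        (isMultiple_sum fun a _ => hxq a).add_le_of_lt hq (isMultiple_rank hq M A)
          (lt_of_le_of_ne (hxr.2 A) (hA A hjA)))
      (fun a => by
        rw [add_smul_stdVec_eq_update]
        by_cases ha : a = j
        · subst ha; simpa using hj'
        · simpa [ha] using hxt a)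
    rw [multilinearExt_add_smul_stdVec] at h
    nlinarith
  have hexch : ∀ i j, i ≠ j → x j < t → 0 < x i → (∀ A, j ∈ A → i ∉ A → ¬ Tight M x A) →
      pd f j x ≤ pd f i x := by
    intro i j hij hj hi hA
    have hj' := (hxq j).add_le_of_lt hq ht hj
    have hi' := (isMultiple_zero q).add_le_of_lt hq (hxq i) hi
    have h := hstep i j _ (by simp) (hxr.exchange hij.symm hδ.le (by linarith) fun A h1 h2 =>
        (isMultiple_sum fun a _ => hxq a).add_le_of_lt hq (isMultiple_rank hq M A)
          (lt_of_le_of_ne (hxr.2 A) (hA A h1 h2)))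
      (fun a => by
        rw [add_smul_stdVec_sub x hij.symm]
        by_cases ha : a = i
        · subst ha
          rw [Function.update_self]
          linarith [hxt a]
        · by_cases hb : a = j
          · subst hb
            rw [Function.update_of_ne ha, Function.update_self]
            exact hj'
          · simpa [ha, hb] using hxt a)
    rw [multilinearExt_exchange f x hij.symm] at h
    -- Convexity along the exchange: the quadratic term is nonnegative, so a failed step bounds the
    -- linear term.
    have hneg := pd_marginal_nonpos hf i j hxr.inBox
    nlinarith [mul_nonpos_of_nonneg_of_nonpos (sq_nonneg (1 / (q : ℝ))) hneg]
  refine ⟨hdown, fun z hz hzt => ?_⟩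
  have hlevel : ∀ θ > 0, 0 ≤ ∑ i ∈ Finset.univ.filter (fun i => θ ≤ pd f i x), (x i - z i) := by
    intro θ hθ
    set L := Finset.univ.filter (fun i => θ ≤ pd f i x) with hL
    -- D is a smallest tight set containing j. It exists because otherwise raising j, with positive
    -- derivative, would improve.
    have hmin : ∀ j ∈ L.filter (fun j => x j < t), ∃ D : Finset X, j ∈ D ∧ Tight M x D ∧
        ∀ i ∈ D, 0 < x i → i ∈ L := by
      intro j hj
      simp only [hL, Finset.mem_filter, Finset.mem_univ, true_and] at hj
      have hne : (Finset.univ.filter fun D : Finset X => j ∈ D ∧ Tight M x D).Nonempty := by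
        by_contra hne
        rw [Finset.not_nonempty_iff_eq_empty, Finset.filter_eq_empty_iff] at hne
        have := hup j hj.2 fun A hjA hA => hne (Finset.mem_univ A) ⟨hjA, hA⟩
        linarith
      obtain ⟨D, hD, hDmin⟩ := Finset.exists_min_image _ Finset.card hne
      simp only [Finset.mem_filter, Finset.mem_univ, true_and] at hD hDmin
      refine ⟨D, hD.1, hD.2, fun i hi hxi => ?_⟩
      simp only [hL, Finset.mem_filter, Finset.mem_univ, true_and]
      by_cases hij : i = j
      · rw [hij]; exact hj.1
      refine hj.1.trans (hexch i j hij hj.2 hxi fun A hjA hiA hA => ?_)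
      -- A tight A with j but without i would make D ∩ A a smaller tight set, so the exchange of i
      -- for j is feasible.
      have h1 := hDmin (D ∩ A) ⟨by simp [hD.1, hjA], (hD.2.union_inter hxr hA).2⟩
      have h2 : (D ∩ A).card < D.card :=
        Finset.card_lt_card ⟨Finset.inter_subset_left, fun h =>
          hiA (Finset.mem_inter.1 (h hi)).2⟩
      omega
    choose! D hD1 hD2 hD3 using hmin
    -- On L, x has the largest possible mass: U is tight and x vanishes on U outside L, while x = t
    -- on L outside U.
    set U := (L.filter (fun j => x j < t)).biUnion D with hU
    have hUt : Tight M x U := tight_biUnion hxr _ _ hD2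
    have hUL : ∀ i ∈ U, i ∉ L → x i = 0 := by
      intro i hi hiL
      obtain ⟨j, hj, hij⟩ := Finset.mem_biUnion.1 hi
      by_contra h
      exact hiL (hD3 j hj i hij (lt_of_le_of_ne (hxr.1 i) (Ne.symm h)))
    have hx1 : ∑ i ∈ L, x i = ∑ i ∈ U, x i + ∑ i ∈ L \ U, x i := by
      rw [← Finset.sum_inter_add_sum_sdiff L U]
      congr 1
      refine Finset.sum_subset Finset.inter_subset_right fun i hi hi' => hUL i hi fun h => ?_
      exact hi' (Finset.mem_inter.2 ⟨h, hi⟩)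
    have hz1 : ∑ i ∈ L, z i ≤ ∑ i ∈ U, z i + ∑ i ∈ L \ U, z i := by
      rw [← Finset.sum_inter_add_sum_sdiff L U]
      gcongr
      · exact fun i _ _ => hz.1 i
      · exact Finset.inter_subset_right
    have h1 : ∑ i ∈ U, z i ≤ ∑ i ∈ U, x i := (hz.2 U).trans hUt.ge
    have h2 : ∑ i ∈ L \ U, z i ≤ ∑ i ∈ L \ U, x i := by
      refine Finset.sum_le_sum fun i hi => (hzt i).trans ?_
      by_contra! h
      rw [Finset.mem_sdiff] at hi
      have hiF : i ∈ L.filter (fun j => x j < t) := Finset.mem_filter.2 ⟨hi.1, h⟩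
      exact hi.2 (Finset.mem_biUnion.2 ⟨i, hiF, hD1 i hiF⟩)
    rw [Finset.sum_sub_distrib]
    linarith
  have habel := sum_posPart_mul_nonneg (fun i => x i - z i) (fun i => pd f i x) hlevel
  -- Where the derivative is negative x is zero, so these coordinates contribute at most zero.
  have hle : ∑ i, pd f i x * (z i - x i) ≤
      -∑ i ∈ Finset.univ.filter (fun i => 0 < pd f i x), pd f i x * (x i - z i) := by
    rw [Finset.sum_filter, ← Finset.sum_neg_distrib]
    refine Finset.sum_le_sum fun i _ => ?_
    split_ifs with h
    · exact le_of_eq (by ring)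
    · rw [neg_zero]
      rcases (not_lt.1 h).eq_or_lt with h0 | h0
      · rw [h0, zero_mul]
      · have : x i = 0 := by
          by_contra hne
          exact absurd (hdown i (lt_of_le_of_ne (hxr.1 i) (Ne.symm hne))) (not_le.2 h0)
        rw [this, sub_zero]
        exact mul_nonpos_of_nonpos_of_nonneg h0.le (hz.1 i)
  linarith

/-- The value of a local optimum of the fractional local search. -/
theorem localOpt_ge {M : Matroid X} {f : Finset X → ℝ} (hf0 : ∀ S, 0 ≤ f S)
    (hf : IsSubmodular f) {q : ℕ} (hq : 0 < q) {t : ℝ} (htq : IsMultiple q t)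
    (ht : t ∈ Set.Icc (0 : ℝ) ((3 - Real.sqrt 5) / 2)) {x : X → ℝ}
    (hxq : ∀ i, IsMultiple q (x i)) (hx : x ∈ boxedPolytope M t)
    (hopt : ¬ ∃ x', Improves M f t (1 / (q : ℝ)) x x') {C : Finset X}
    (hC : M.Indep (C : Set X)) : (t - t ^ 2 / 2) * f C ≤ multilinearExt f x := by
  obtain ⟨h1, h2⟩ := localOpt_first_order hf hq htq hxq hx hopt
  rw [mem_boxedPolytope_iff] at hx
  have ht1 : t ≤ 1 := by
    have : (1 : ℝ) ≤ Real.sqrt 5 := Real.le_sqrt_of_sq_le (by norm_num)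
    linarith [ht.2]
  have ht0 := ht.1
  refine multilinearExt_ge_of_first_order hf0 hf ht (fun i => ⟨hx.1.1 i, hx.2 i⟩) C h1
    (h2 _ ?_ fun i => ?_)
  -- The test point lies below t 1_C + (1-t) x, and the polytope is closed downwards.
  · refine (convex_rankPolytope M (rankPolytope_charVec hC) hx.1 ht0 (sub_nonneg.2 ht1)
      (by ring)).mono (fun i => ?_) fun i => ?_
    · split_ifs
      · exact ht0
      · exact mul_nonneg (sub_nonneg.2 ht1) (hx.1.1 i)
    · simp only [Pi.add_apply, Pi.smul_apply, smul_eq_mul, charVec_coe_apply]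
      split_ifs
      · linarith [mul_nonneg (sub_nonneg.2 ht1) (hx.1.1 i)]
      · linarith
  · split_ifs
    · exact le_rfl
    · nlinarith [hx.1.1 i, hx.2 i]

end LocalOptimum

/-! ### One pipage step -/

section Rounding

variable {X : Type*} [Fintype X] [DecidableEq X]

lemma IsFractional.eq_of_not {a : ℝ} (h0 : 0 ≤ a) (h1 : a ≤ 1) (h : ¬ IsFractional a) :
    a = 0 ∨ a = 1 := by
  unfold IsFractional at h
  by_contra! h'
  exact h ⟨lt_of_le_of_ne h0 h'.1.symm, lt_of_le_of_ne h1 h'.2⟩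

/-- A set whose rank inequality is tight does not contain exactly one fractional variable. -/
lemma Tight.exists_second_fractional {N : Matroid X} {y : X → ℝ} (hy : RankPolytope N y)
    {A : Finset X} (hA : Tight N y A) {i : X} (hi : i ∈ A) (hif : IsFractional (y i)) :
    ∃ j ∈ A, i ≠ j ∧ IsFractional (y j) := by
  by_contra! h
  -- If all other entries were 0 or 1, the integral rank would force y_i to be an integer.
  have h1 : IsMultiple 1 (∑ a ∈ A.erase i, y a) := isMultiple_sum fun a ha => by
    rcases IsFractional.eq_of_not (hy.1 a) (hy.le_one a)
      (h a (Finset.mem_of_mem_erase ha) (Finset.ne_of_mem_erase ha).symm) with h | h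
    · exact ⟨0, by simp [h]⟩
    · exact ⟨1, by simp [h]⟩
  obtain ⟨k, hk⟩ := h1
  obtain ⟨l, hl⟩ := isMultiple_rank Nat.one_pos N A
  have h2 := Finset.add_sum_erase A y hi
  unfold Tight at hA
  rw [hA, hk, hl] at h2
  have h3 : y i = ((l - k : ℤ) : ℝ) := by push_cast at h2 ⊢; linarith
  rw [h3] at hif
  obtain ⟨h4, h5⟩ := hif
  have h6 : 0 < l - k := by exact_mod_cast h4
  have h7 : l - k < 1 := by exact_mod_cast h5
  omega

/-- The result of `HitConstraint` in a point of the base polytope, for a pair of fractional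
variables in a tight set `T`. -/
lemma HitConstraint.spec {N : Matroid X} {y y' : X → ℝ} {i j : X} {A' T : Finset X}
    (h : HitConstraint N y i j y' A') (hy : RankPolytope N y) (hu : Tight N y Finset.univ)
    (hij : i ≠ j) (hif : IsFractional (y i)) (hjf : IsFractional (y j)) (hT : Tight N y T)
    (hiT : i ∈ T) (hjT : j ∈ T) :
    (∃ γ : ℝ, 0 ≤ γ ∧ y' = y + γ • (stdVec i - stdVec j)) ∧ RankPolytope N y' ∧
      Tight N y' Finset.univ ∧ (∀ a, IsFractional (y' a) → IsFractional (y a)) ∧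
      (∃ k ∈ T, k ∈ A' ∧ IsFractional (y k) ∧ ((∀ a ∈ T ∩ A', ¬ IsFractional (y' a)) →
        ¬ IsFractional (y' k))) ∧ (∃ k ∈ T, k ∉ A') ∧
      (Tight N y' (T ∩ A') ∨ ∀ a ∈ T ∩ A', ¬ IsFractional (y' a)) := by
  obtain ⟨A, ⟨hAE, hiA, hjA⟩, hmin, hcase⟩ := h
  have hslack : 0 ≤ rank N A - ∑ a ∈ A, y a := sub_nonneg.2 (hy.2 A)
  -- Minimality extends from subsets of N.E to all sets, since rank and y ignore elements outside
  -- N.E.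
  have hmin' : ∀ B : Finset X, i ∈ B → j ∉ B →
      rank N A - ∑ a ∈ A, y a ≤ rank N B - ∑ b ∈ B, y b := by
    intro B hi hj
    classical
    have hi' : i ∈ N.E := hAE hiA
    have h1 := hmin (B.filter (· ∈ N.E)) (fun a ha => by simpa using (Finset.mem_filter.1 ha).2)
      (by simp [hi, hi']) (by simp [hj])
    have h2 : rank N (B.filter (· ∈ N.E)) = rank N B := rank_congr N (by ext a; simp)
    have h3 : ∑ b ∈ B.filter (· ∈ N.E), y b = ∑ b ∈ B, y b := by
      refine Finset.sum_subset (Finset.filter_subset _ _) fun a haB ha => ?_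
      have haE : a ∉ N.E := fun h => ha (Finset.mem_filter.2 ⟨haB, h⟩)
      have := hy.2 {a}
      rw [rank_singleton_of_notMem N haE, Finset.sum_singleton] at this
      exact le_antisymm this (hy.1 a)
    rwa [h2, h3] at h1
  have common : ∀ γ : ℝ, 0 ≤ γ → γ ≤ y j → γ ≤ rank N A - ∑ a ∈ A, y a →
      y' = y + γ • (stdVec i - stdVec j) → RankPolytope N y' ∧ Tight N y' Finset.univ ∧
      (∀ a, IsFractional (y' a) → IsFractional (y a)) ∧ Tight N y' T := by
    intro γ h0 hγj hγA he
    rw [he]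
    refine ⟨hy.exchange hij h0 hγj fun B hi hj => ?_, ?_, fun a ha => ?_, ?_⟩
    · linarith [hmin' B hi hj]
    · unfold Tight at hu ⊢
      rw [sum_add_smul_stdVec_sub, hu]; simp
    · by_cases hai : a = i
      · rw [hai]; exact hif
      by_cases haj : a = j
      · rw [haj]; exact hjf
      rwa [add_smul_stdVec_sub y hij, Function.update_of_ne haj, Function.update_of_ne hai] at ha
    · unfold Tight at hT ⊢
      rw [sum_add_smul_stdVec_sub, hT]; simp [hiT, hjT]
  -- Either y_j drops to 0 and T ∩ {j} has no fractional variable left, or A' becomes tight and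
  -- uncrosses with T, which stays tight because it contains both i and j.
  rcases hcase with ⟨hlt, hy', rfl⟩ | ⟨hle, hy', rfl⟩
  · obtain ⟨c1, c2, c3, -⟩ := common _ hjf.1.le le_rfl hlt.le hy'
    have hj0 : ¬ IsFractional (y' j) := by
      rw [hy', add_smul_stdVec_sub y hij]
      simp [IsFractional]
    exact ⟨⟨y j, hjf.1.le, hy'⟩, c1, c2, c3, ⟨j, hjT, by simp, hjf, fun _ => hj0⟩,
      ⟨i, hiT, by simpa using hij⟩, Or.inr fun a ha => by
        rw [Finset.mem_inter, Finset.mem_singleton] at ha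
        rw [ha.2]; exact hj0⟩
  · obtain ⟨c1, c2, c3, c4⟩ := common _ hslack hle le_rfl hy'
    have hAt : Tight N y' A' := by
      unfold Tight
      rw [hy', sum_add_smul_stdVec_sub]
      simp [hiA, hjA]
    exact ⟨⟨rank N A' - ∑ a ∈ A', y a, hslack, hy'⟩, c1, c2, c3,
      ⟨i, hiT, hiA, hif, fun h => h i (Finset.mem_inter.2 ⟨hiT, hiA⟩)⟩,
      ⟨j, hjT, hjA⟩, Or.inl (c4.union_inter c1 hAt).2⟩

lemma exists_hitConstraint (N : Matroid X) (y : X → ℝ) {i j : X} (hi : i ∈ N.E) (hij : i ≠ j) :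
    ∃ y' A', HitConstraint N y i j y' A' := by
  classical
  obtain ⟨A, hA, hmin⟩ := Finset.exists_min_image
    (Finset.univ.filter fun A : Finset X => (A : Set X) ⊆ N.E ∧ i ∈ A ∧ j ∉ A)
    (fun A => rank N A - ∑ a ∈ A, y a) ⟨{i}, by simpa using ⟨hi, hij.symm⟩⟩
  simp only [Finset.mem_filter, Finset.mem_univ, true_and] at hA hmin
  rcases lt_or_ge (y j) (rank N A - ∑ a ∈ A, y a) with h | h
  · exact ⟨_, _, A, hA, fun B h1 h2 h3 => hmin B ⟨h1, h2, h3⟩, Or.inl ⟨h, rfl, rfl⟩⟩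
  · exact ⟨_, _, A, hA, fun B h1 h2 h3 => hmin B ⟨h1, h2, h3⟩, Or.inr ⟨h, rfl, rfl⟩⟩

lemma norm_toLp_smul_stdVec_sub (i j : X) {c : ℝ} (hc : 0 ≤ c) :
    ‖(WithLp.toLp 2 (c • (stdVec i - stdVec j : X → ℝ)))‖ =
      c * ‖(WithLp.toLp 2 (stdVec i - stdVec j : X → ℝ))‖ := by
  rw [WithLp.toLp_smul, norm_smul, Real.norm_of_nonneg hc]

lemma norm_toLp_stdVec_sub_pos {i j : X} (hij : i ≠ j) :
    0 < ‖(WithLp.toLp 2 (stdVec i - stdVec j : X → ℝ))‖ := by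
  rw [norm_pos_iff]
  intro h
  have := congrArg (fun v => v i) h
  simp [stdVec, hij] at this

/-- Both displacements are multiples of e_i - e_j, so the norms reduce to their lengths. The
resulting equation says that the random displacement has mean zero. -/
lemma pipage_norm_iff {y yp ym : X → ℝ} {i j : X} (hij : i ≠ j) {γ γ' p : ℝ} (hγ : 0 ≤ γ)
    (hγ' : 0 ≤ γ') (hp : yp = y + γ • (stdVec i - stdVec j))
    (hm : ym = y + γ' • (stdVec j - stdVec i)) :
    p * ‖WithLp.toLp 2 (yp - ym)‖ = ‖WithLp.toLp 2 (yp - y)‖ ↔ p * (γ + γ') = γ := by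
  have e1 : yp - y = γ • (stdVec i - stdVec j) := by rw [hp]; simp
  have e2 : yp - ym = (γ + γ') • (stdVec i - stdVec j) := by
    rw [hp, hm]; ext a; simp; ring
  rw [e1, e2, norm_toLp_smul_stdVec_sub i j hγ, norm_toLp_smul_stdVec_sub i j (add_nonneg hγ hγ'),
    ← mul_assoc]
  exact mul_left_inj' (norm_toLp_stdVec_sub_pos hij).ne'

/-- Jensen's inequality for the convex quadratic along e_i - e_j: the linear terms average to zero.
-/
lemma pipage_value {f : Finset X → ℝ} (hf : IsSubmodular f) {y : X → ℝ} (hy : InBox y) {i j : X}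
    (hij : i ≠ j) {γ γ' p : ℝ} (hp0 : 0 ≤ p) (hp1 : p ≤ 1) (hp : p * (γ + γ') = γ) :
    multilinearExt f y ≤ p * multilinearExt f (y + γ' • (stdVec j - stdVec i)) +
      (1 - p) * multilinearExt f (y + γ • (stdVec i - stdVec j)) := by
  have e : y + γ' • (stdVec j - stdVec i) = y + (-γ') • (stdVec i - stdVec j) := by
    ext a; simp; ring
  rw [e, multilinearExt_exchange f y hij, multilinearExt_exchange f y hij]
  have hq := pd_marginal_nonpos hf j i hy
  set Q := pd (marginal f j) i y
  have h1 : p * (-γ') ^ 2 * Q + (1 - p) * γ ^ 2 * Q ≤ 0 := by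
    have a1 : 0 ≤ p * (-γ') ^ 2 := by positivity
    have a2 : 0 ≤ (1 - p) * γ ^ 2 := mul_nonneg (sub_nonneg.2 hp1) (sq_nonneg _)
    linarith [mul_nonpos_of_nonneg_of_nonpos a1 hq, mul_nonpos_of_nonneg_of_nonpos a2 hq]
  have h2 : (p * (-γ') + (1 - p) * γ) * (pd f i y - pd f j y) = 0 := by
    have : p * (-γ') + (1 - p) * γ = 0 := by linarith
    rw [this, zero_mul]
  nlinarith

/-! ### One round of Adjust -/

lemma raise_value (f : Finset X → ℝ) (x : X → ℝ) (i : X) {ε p : ℝ} (h : p * (x i + ε) = x i) :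
    multilinearExt f x = p * multilinearExt f (Function.update x i (x i + ε)) +
      (1 - p) * multilinearExt f (Function.update x i 0) := by
  -- F is affine in coordinate i, and `h` says that its mean stays x_i.
  rw [multilinearExt_update_eq, multilinearExt_update_eq]
  linear_combination (-pd f i x) * h

/-- The coordinates that can be increased within the matroid polytope. -/
def raisable (N : Matroid X) (x : X → ℝ) : Set X :=
  {i | i ∈ N.E ∧ ∃ ε : ℝ, 0 < ε ∧ x + ε • stdVec i ∈ polytope N}

/-- Only sets containing i limit the increase, so its maximum is the least slack among them. -/
lemma exists_isGreatest_raise {N : Matroid X} {x : X → ℝ} (hx : RankPolytope N x) (i : X) :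
    ∃ ε, IsGreatest {d : ℝ | x + d • stdVec i ∈ polytope N} ε := by
  obtain ⟨A, hA, hmin⟩ := Finset.exists_min_image
    (Finset.univ.filter fun A : Finset X => i ∈ A)
    (fun A => rank N A - ∑ a ∈ A, x a) ⟨{i}, by simp⟩
  simp only [Finset.mem_filter, Finset.mem_univ, true_and] at hA hmin
  refine ⟨rank N A - ∑ a ∈ A, x a, ?_, fun d hd => ?_⟩
  · refine mem_polytope_iff.2 (hx.add_smul_stdVec ?_ fun B hB => ?_)
    · linarith [hx.1 i, hx.2 A]
    · linarith [hmin B hB]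
  · have := (mem_polytope_iff.1 hd).2 A
    rw [sum_add_smul_stdVec, if_pos hA] at this
    linarith

lemma exists_tight_of_notMem_raisable {N : Matroid X} {x : X → ℝ} (hx : RankPolytope N x) {i : X}
    (hi : i ∈ N.E) (h : i ∉ raisable N x) : ∃ A : Finset X, i ∈ A ∧ Tight N x A := by
  obtain ⟨A, hA, hmin⟩ := Finset.exists_min_image
    (Finset.univ.filter fun A : Finset X => i ∈ A)
    (fun A => rank N A - ∑ a ∈ A, x a) ⟨{i}, by simp⟩
  simp only [Finset.mem_filter, Finset.mem_univ, true_and] at hA hmin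
  refine ⟨A, hA, le_antisymm (hx.2 A) ?_⟩
  by_contra! hlt
  refine h ⟨hi, rank N A - ∑ a ∈ A, x a, by linarith, ?_⟩
  refine mem_polytope_iff.2 (hx.add_smul_stdVec ?_ fun B hB => ?_)
  · linarith [hx.1 i, hx.2 A]
  · linarith [hmin B hB]

/-- A point of the matroid polytope none of whose coordinates can be increased is in the base
polytope. -/
lemma mem_basePolytope_of_raisable_empty {N : Matroid X} {x : X → ℝ} (hx : RankPolytope N x)
    (h : ∀ i ∈ N.E, i ∉ raisable N x) : x ∈ basePolytope N := by
  refine mem_basePolytope_iff.2 ⟨hx, le_antisymm (hx.2 _) ?_⟩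
  choose! D hD1 hD2 using fun i hi => exists_tight_of_notMem_raisable hx hi (h i hi)
  -- Every element lies in a tight set; their union is tight and covers the ground set.
  have hU := tight_biUnion hx N.E.toFinite.toFinset D (fun i hi => hD2 i (by simpa using hi))
  rw [← rank_eq_univ N (A := N.E.toFinite.toFinset.biUnion D) fun i hi => by
    simp only [Finset.coe_biUnion, Set.mem_iUnion]
    exact ⟨i, by simpa using hi, hD1 i hi⟩]
  rw [← hU]
  exact Finset.sum_le_sum_of_subset_of_nonneg (Finset.subset_univ _) fun i _ _ => hx.1 i

/-- The polytope is closed downwards, so no coordinate becomes raisable; i itself stops being so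
because ε was maximal. -/
lemma raisable_raise_ssubset {N : Matroid X} {x : X → ℝ} (hx : RankPolytope N x) {i : X}
    (hi : i ∈ N.E) {ε : ℝ} (hε : IsGreatest {d : ℝ | x + d • stdVec i ∈ polytope N} ε)
    (hε0 : 0 < ε) : raisable N (x + ε • stdVec i) ⊂ raisable N x := by
  refine ⟨fun j hj => ?_, fun h => ?_⟩
  · obtain ⟨hj, η, hη, hjη⟩ := hj
    refine ⟨hj, η, hη, mem_polytope_iff.2 ((mem_polytope_iff.1 hjη).mono (fun a => ?_) fun a => ?_)⟩
    · have : 0 ≤ η * stdVec j a := mul_nonneg hη.le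
        (by simp [stdVec, Pi.single_apply]; split_ifs <;> simp)
      simpa using add_nonneg (hx.1 a) this
    · have : 0 ≤ ε * stdVec i a := mul_nonneg hε0.le
        (by simp [stdVec, Pi.single_apply]; split_ifs <;> simp)
      simp only [Pi.add_apply, Pi.smul_apply, smul_eq_mul]
      linarith
  · obtain ⟨-, η, hη, hiη⟩ := h ⟨hi, ε, hε0, hε.1⟩
    have : x + ε • stdVec i + η • stdVec i = x + (ε + η) • stdVec i := by
      rw [add_smul, add_assoc]
    rw [this] at hiη
    linarith [hε.2 hiη]

lemma rankPolytope_delete {N : Matroid X} {x : X → ℝ} (hx : RankPolytope N x) {i : X}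
    (hi : x i = 0) : RankPolytope (N.delete {i}) x := by
  refine ⟨hx.1, fun A => ?_⟩
  rw [rank_delete, ← Finset.sum_erase A hi]
  exact hx.2 _

end Rounding

/-! ### Invariant, termination measure and expected value -/

section Algorithm

variable {X : Type*} [Fintype X] [DecidableEq X]

/-- The invariant of the algorithm. -/
def Inv (M : Matroid X) (q : ℕ) (t : ℝ) : State X → Prop
  | .search x => (∀ i, IsMultiple q (x i)) ∧ x ∈ boxedPolytope M t
  | .adjust N x => (∀ I, N.Indep I → M.Indep I) ∧ RankPolytope N x
  | .adjustDelete N x => (∀ I, N.Indep I → M.Indep I) ∧ RankPolytope N x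
  | .outer N y => (∀ I, N.Indep I → M.Indep I) ∧ RankPolytope N y ∧ Tight N y Finset.univ
  | .inner N y T => (∀ I, N.Indep I → M.Indep I) ∧ RankPolytope N y ∧ Tight N y Finset.univ ∧
      -- Tightness of T may be lost, but only when the inner loop is about to end.
      T ⊆ N.E ∧ ((∃ A : Finset X, (A : Set X) = T ∧ Tight N y A) ∨ ∀ i ∈ T, ¬ IsFractional (y i))
  | .done S => M.Indep (S : Set X)

/-- A lower bound for the expected value of the output from a configuration. -/
def value (f : Finset X → ℝ) (c : ℝ) : State X → ℝ
  | .search _ => c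
  | .adjust _ x => multilinearExt f x
  | .adjustDelete _ x => multilinearExt f x
  | .outer _ y => multilinearExt f y
  | .inner _ y _ => multilinearExt f y
  | .done S => f S

/-- The phases of the algorithm, in decreasing order. -/
def phase : State X → ℕ
  | .search _ => 3
  | .adjust _ _ => 2
  | .adjustDelete _ _ => 2
  | .outer _ _ => 1
  | .inner _ _ _ => 1
  | .done _ => 0

/-- The points that the local search can still visit. -/
def betterPoints (M : Matroid X) (f : Finset X → ℝ) (q : ℕ) (t : ℝ) (x : X → ℝ) : Set (X → ℝ) :=
  {y | (∀ i, IsMultiple q (y i)) ∧ y ∈ boxedPolytope M t ∧ multilinearExt f x < multilinearExt f y}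

open Classical in
/-- A bound for the number of steps that remain in the current phase. -/
noncomputable def remaining (M : Matroid X) (f : Finset X → ℝ) (q : ℕ) (t : ℝ) : State X → ℕ
  | .search x => (betterPoints M f q t x).ncard
  -- A deletion frees 2|X| + 2, enough to restart with up to |X| raisable coordinates, each counted
  -- twice for its two substeps.
  | .adjust N x => N.E.ncard * (2 * Fintype.card X + 2) + 2 * (raisable N x).ncard + 1
  | .adjustDelete N x => if ∃ i ∈ N.E, x i = 0 then N.E.ncard * (2 * Fintype.card X + 2) else
      N.E.ncard * (2 * Fintype.card X + 2) + 2 * (raisable N x).ncard + 2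
  | .outer _ y => {i | IsFractional (y i)}.ncard * (Fintype.card X + 5) + Fintype.card X + 2
  | .inner _ y T => if ∃ i ∈ T, IsFractional (y i) then
      {i | IsFractional (y i)}.ncard * (Fintype.card X + 5) + T.ncard + 1 else
      {i | IsFractional (y i)}.ncard * (Fintype.card X + 5) + Fintype.card X + 3
  | .done _ => 0

/-- The measure that decreases in every step. -/
noncomputable def measure (M : Matroid X) (f : Finset X → ℝ) (q : ℕ) (t : ℝ) (s : State X) : ℕ ×ₗ ℕ :=
  toLex (phase s, remaining M f q t s)

lemma coin_self {σ : Type*} {p : ℝ≥0} (hp : p ≤ 1) (a : σ) : coin p hp a a = PMF.pure a := by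
  unfold coin
  simp only [ite_self]
  exact PMF.map_const _ _

lemma coin_bind {σ τ : Type*} {p : ℝ≥0} (hp : p ≤ 1) (a b : σ) (ν : σ → PMF τ) (S : τ) :
    ((coin p hp a b).bind ν) S = p * ν a S + ((1 - p : ℝ≥0) : ENNReal) * ν b S := by
  unfold coin
  rw [PMF.bind_map, PMF.bind_apply, tsum_bool]
  simp [PMF.ofFintype_apply, add_comm]

lemma mem_support_coin {σ : Type*} {p : ℝ≥0} {hp : p ≤ 1} {a b s : σ} :
    s ∈ (coin p hp a b).support ↔ (s = a ∧ p ≠ 0) ∨ (s = b ∧ 1 - p ≠ 0) := by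
  unfold coin
  rw [PMF.mem_support_map_iff]
  simp only [PMF.mem_support_ofFintype_iff, Bool.exists_bool]
  simp only [Bool.false_eq_true, if_false, if_true, ne_eq, ENNReal.coe_eq_zero]
  tauto

lemma expectedValue_coin_bind (f : Finset X → ℝ) {p : ℝ≥0} (hp : p ≤ 1) {σ : Type*} (a b : σ)
    (ν : σ → PMF (Finset X)) : expectedValue f ((coin p hp a b).bind ν) =
      p * expectedValue f (ν a) + (1 - p) * expectedValue f (ν b) := by
  unfold expectedValue
  rw [Finset.mul_sum, Finset.mul_sum, ← Finset.sum_add_distrib]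
  refine Finset.sum_congr rfl fun S _ => ?_
  rw [coin_bind, ENNReal.toReal_add (ENNReal.mul_ne_top ENNReal.coe_ne_top (PMF.apply_ne_top _ _))
    (ENNReal.mul_ne_top ENNReal.coe_ne_top (PMF.apply_ne_top _ _)), ENNReal.toReal_mul,
    ENNReal.toReal_mul, ENNReal.coe_toReal, ENNReal.coe_toReal, NNReal.coe_sub hp, NNReal.coe_one]
  ring

/-- A distribution with at most two outcomes, both of which satisfy the invariant and have a smaller
measure, and with an expected value at least that of `s`. -/
def GoodStep (M : Matroid X) (f : Finset X → ℝ) (q : ℕ) (t c : ℝ) (s : State X)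
    (μ : PMF (State X)) : Prop :=
  ∃ (p : ℝ≥0) (hp : p ≤ 1) (a b : State X), μ = coin p hp a b ∧
    Inv M q t a ∧ Inv M q t b ∧ measure M f q t a < measure M f q t s ∧
    measure M f q t b < measure M f q t s ∧
    value f c s ≤ p * value f c a + (1 - p) * value f c b

lemma goodStep_pure {M : Matroid X} {f : Finset X → ℝ} {q : ℕ} {t c : ℝ} {s s' : State X}
    (h1 : Inv M q t s') (h2 : measure M f q t s' < measure M f q t s)
    (h3 : value f c s ≤ value f c s') : GoodStep M f q t c s (PMF.pure s') :=
  ⟨1, le_rfl, s', s', (coin_self le_rfl s').symm, h1, h1, h2, h2, by simpa using h3⟩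

lemma measure_lt_of_phase {M : Matroid X} {f : Finset X → ℝ} {q : ℕ} {t : ℝ} {s s' : State X}
    (h : phase s' < phase s) : measure M f q t s' < measure M f q t s :=
  Prod.Lex.toLex_lt_toLex.2 (Or.inl h)

lemma measure_lt_of_remaining {M : Matroid X} {f : Finset X → ℝ} {q : ℕ} {t : ℝ} {s s' : State X}
    (h : phase s' = phase s) (h' : remaining M f q t s' < remaining M f q t s) :
    measure M f q t s' < measure M f q t s :=
  Prod.Lex.toLex_lt_toLex.2 (Or.inr ⟨h, h'⟩)

lemma finite_betterPoints (M : Matroid X) (f : Finset X → ℝ) {q : ℕ} (hq : 0 < q) (t : ℝ)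
    (x : X → ℝ) : (betterPoints M f q t x).Finite := by
  have hfin : ((fun k : ℤ => (k : ℝ) / q) '' (Set.Icc 0 q)).Finite :=
    (Set.finite_Icc _ _).image _
  refine (Set.Finite.pi' fun _ : X => hfin).subset ?_
  rintro y ⟨h1, h2, -⟩ i
  obtain ⟨k, hk⟩ := h1 i
  have hb := (mem_boxedPolytope_iff.1 h2).1.inBox i
  have hq' : (0 : ℝ) < q := Nat.cast_pos.2 hq
  rw [hk, le_div_iff₀ hq', zero_mul, div_le_one hq'] at hb
  exact ⟨k, ⟨by exact_mod_cast hb.1, by exact_mod_cast hb.2⟩, hk.symm⟩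

lemma isMultiple_move {q : ℕ} {x x' : X → ℝ} {M : Matroid X} {f : Finset X → ℝ} {t : ℝ}
    (hx : ∀ i, IsMultiple q (x i)) (h : Improves M f t (1 / (q : ℝ)) x x') :
    ∀ i, IsMultiple q (x' i) := by
  obtain ⟨i, j, v, hv, rfl, -, -⟩ := h
  have hs : ∀ a b : X, ∃ k : ℤ, (stdVec a : X → ℝ) b = k := fun a b => by
    by_cases h : b = a
    · exact ⟨1, by simp [stdVec, h]⟩
    · exact ⟨0, by simp [stdVec, h]⟩
  intro a
  have hk : ∃ k : ℤ, v a = k := by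
    obtain ⟨k, hk⟩ := hs i a
    obtain ⟨l, hl⟩ := hs j a
    rcases hv with rfl | rfl | rfl
    · exact ⟨l, hl⟩
    · exact ⟨-k, by simp [hk]⟩
    · exact ⟨l - k, by simp [hk, hl]⟩
  obtain ⟨k, hk⟩ := hk
  refine (hx a).add ⟨k, ?_⟩
  simp [hk]
  ring

lemma ncard_le_card (s : Set X) : s.ncard ≤ Fintype.card X := by
  rw [← Nat.card_eq_fintype_card]
  exact Set.ncard_le_card s

lemma remaining_adjustDelete_lt {M N : Matroid X} {f : Finset X → ℝ} {q : ℕ} {t : ℝ}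
    {x x' : X → ℝ} (h : (∃ i ∈ N.E, x' i = 0) ∨ raisable N x' ⊂ raisable N x) :
    remaining M f q t (.adjustDelete N x') < remaining M f q t (.adjust N x) := by
  simp only [remaining]
  split_ifs with h0
  · omega
  · have := Set.ncard_lt_ncard (h.resolve_left h0)
    omega

lemma remaining_inner_lt {M N : Matroid X} {f : Finset X → ℝ} {q : ℕ} {t : ℝ}
    {y y' : X → ℝ} {T T' : Set X} (hT : T' ⊂ T) (hf : ∃ i ∈ T, IsFractional (y i))
    (hy : ∀ i, IsFractional (y' i) → IsFractional (y i))
    (hk : ∃ k ∈ T', IsFractional (y k) ∧ ((∀ a ∈ T', ¬ IsFractional (y' a)) →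
      ¬ IsFractional (y' k))) :
    remaining M f q t (.inner N y' T') < remaining M f q t (.inner N y T) := by
  simp only [remaining]
  rw [if_pos hf]
  have hsub : {i | IsFractional (y' i)} ⊆ {i | IsFractional (y i)} := hy
  split_ifs with h0
  · have h1 := Set.ncard_lt_ncard hT
    have h2 := Nat.mul_le_mul_right (Fintype.card X + 5) (Set.ncard_le_ncard hsub)
    omega
  · obtain ⟨k, -, hk1, hk2⟩ := hk
    have hss : {i | IsFractional (y' i)} ⊂ {i | IsFractional (y i)} :=
      ⟨hsub, fun h => hk2 (by simpa using h0) (h hk1)⟩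
    have h2 := Nat.mul_le_mul_right (Fintype.card X + 5) (Set.ncard_lt_ncard hss)
    rw [Nat.succ_mul] at h2
    omega

lemma eq_zero_of_notMem_ground {N : Matroid X} {y : X → ℝ} (hy : RankPolytope N y) {i : X}
    (hi : i ∉ N.E) : y i = 0 := by
  have := hy.2 {i}
  rw [rank_singleton_of_notMem N hi, Finset.sum_singleton] at this
  exact le_antisymm this (hy.1 i)

/-- The bound by c is required only at local optima, since the value is constant throughout the
search. -/
theorem Step.goodStep {M : Matroid X} {f : Finset X → ℝ} (hf : IsSubmodular f) {q : ℕ}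
    (hq : 0 < q) {t c : ℝ}
    (hc : ∀ x, (∀ i, IsMultiple q (x i)) → x ∈ boxedPolytope M t →
      (¬ ∃ x', Improves M f t (1 / (q : ℝ)) x x') → c ≤ multilinearExt f x)
    {s : State X} {μ : PMF (State X)} (h : Step M f t (1 / (q : ℝ)) s μ) (hs : Inv M q t s) :
    GoodStep M f q t c s μ := by
  classical
  cases h with
  | move x x' h =>
    have hx' := isMultiple_move hs.1 h
    obtain ⟨i, j, v, hv, e, hb, hlt⟩ := h
    refine goodStep_pure ⟨hx', hb⟩ (measure_lt_of_remaining rfl ?_) le_rfl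
    refine Set.ncard_lt_ncard ⟨fun y hy => ⟨hy.1, hy.2.1, hlt.trans hy.2.2⟩, fun h => ?_⟩
      (finite_betterPoints M f hq t x)
    exact lt_irrefl _ (h ⟨hx', hb, hlt⟩ : x' ∈ betterPoints M f q t x').2.2
  | localOpt x h =>
    exact goodStep_pure ⟨fun _ h => h, (mem_boxedPolytope_iff.1 hs.2).1⟩
      (measure_lt_of_phase (by simp [phase])) (hc x hs.1 hs.2 h)
  | raise N x i ε p hp hx hi hε hε0 hpx =>
    obtain ⟨hN, hxr⟩ := hs
    have hpos : 0 < x i + ε := by linarith [hxr.1 i]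
    have e : x + ε • stdVec i = Function.update x i (x i + ε) := add_smul_stdVec_eq_update x i ε
    refine ⟨p, hp, _, _, rfl, ⟨hN, ?_⟩, ⟨hN, ?_⟩, measure_lt_of_remaining rfl ?_,
      measure_lt_of_remaining rfl ?_, ?_⟩
    · rw [← e]; exact mem_polytope_iff.1 hε.1
    · have hle : Function.update x i 0 ≤ x := update_le_iff.2 ⟨hxr.1 i, fun _ _ => le_rfl⟩
      refine hxr.mono (fun a => ?_) hle
      by_cases ha : a = i
      · subst ha; simp
      · simpa [ha] using hxr.1 a
    · rw [← e]
      exact remaining_adjustDelete_lt (Or.inr (raisable_raise_ssubset hxr hi hε hε0))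
    · exact remaining_adjustDelete_lt (Or.inl ⟨i, hi, by simp⟩)
    · exact (raise_value f x i (by rw [hpx]; field_simp)).le
  | noRaise N x hx h =>
    -- Under the invariant this step is impossible: outside the base polytope some coordinate can be
    -- raised.
    exact absurd (mem_basePolytope_of_raisable_empty hs.2 fun i hi hr => h ⟨i, hi, hr.2⟩) hx
  | delete N x i hi hxi =>
    obtain ⟨hN, hxr⟩ := hs
    refine goodStep_pure ⟨fun I hI => hN I hI.of_delete, rankPolytope_delete hxr hxi⟩
      (measure_lt_of_remaining rfl ?_) le_rfl
    simp only [remaining]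
    rw [if_pos ⟨i, hi, hxi⟩, Matroid.delete_ground]
    have h1 : (N.E \ {i}).ncard + 1 = N.E.ncard := Set.ncard_sdiff_singleton_add_one hi
    have h2 := ncard_le_card (raisable (N.delete {i}) x)
    rw [← h1, Nat.add_one_mul (N.E \ {i}).ncard]
    omega
  | noDelete N x h =>
    refine goodStep_pure hs (measure_lt_of_remaining rfl ?_) le_rfl
    simp only [remaining]
    rw [if_neg (by push Not; exact h)]
    omega
  | adjusted N x hx =>
    exact goodStep_pure ⟨hs.1, hs.2, (mem_basePolytope_iff.1 hx).2⟩
      (measure_lt_of_phase (by simp [phase])) le_rfl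
  | enter N y hy =>
    obtain ⟨hN, hyr, hyu⟩ := hs
    refine goodStep_pure ⟨hN, hyr, hyu, subset_rfl,
      Or.inl ⟨N.E.toFinite.toFinset, by simp, ?_⟩⟩ (measure_lt_of_remaining rfl ?_) le_rfl
    · unfold Tight at hyu ⊢
      rw [rank_eq_univ N (by simp), ← hyu]
      exact Finset.sum_subset (Finset.subset_univ _) fun i _ hi =>
        eq_zero_of_notMem_ground hyr (by simpa using hi)
    · simp only [remaining]
      rw [if_pos hy]
      have := ncard_le_card N.E
      omega
  | pipage N y T i j hij hi hj yp ym Ap Am hyp hym p hp hpy =>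
    obtain ⟨hN, hyr, hyu, hTE, hT⟩ := hs
    obtain ⟨A, rfl, hA⟩ := hT.resolve_right fun h => h i hi.1 hi.2
    obtain ⟨⟨γ, hγ, ep⟩, p1, p2, p3, ⟨k, hkT, hkA, hk⟩, ⟨l, hlT, hlA⟩, p4⟩ :=
      hyp.spec hyr hyu hij hi.2 hj.2 hA hi.1 hj.1
    obtain ⟨⟨γ', hγ', em⟩, m1, m2, m3, ⟨k', hkT', hkA', hk'⟩, ⟨l', hlT', hlA'⟩, m4⟩ :=
      hym.spec hyr hyu hij.symm hj.2 hi.2 hA hj.1 hi.1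
    have hpγ := (pipage_norm_iff hij hγ hγ' ep em).1 hpy
    refine ⟨p, hp, _, _, rfl,
      ⟨hN, m1, m2, Set.inter_subset_left.trans hTE, ?_⟩,
      ⟨hN, p1, p2, Set.inter_subset_left.trans hTE, ?_⟩,
      measure_lt_of_remaining rfl (remaining_inner_lt ?_ ⟨i, hi⟩ m3 ?_),
      measure_lt_of_remaining rfl (remaining_inner_lt ?_ ⟨i, hi⟩ p3 ?_), ?_⟩
    · exact m4.imp (fun h => ⟨_, by simp, h⟩) fun h a ha => h a (by simpa using ha)
    · exact p4.imp (fun h => ⟨_, by simp, h⟩) fun h a ha => h a (by simpa using ha)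
    · exact ⟨Set.inter_subset_left, fun h => hlA' (h hlT').2⟩
    · exact ⟨k', ⟨hkT', hkA'⟩, hk'.1, fun h => hk'.2 fun a ha => h a (by simpa using ha)⟩
    · exact ⟨Set.inter_subset_left, fun h => hlA (h hlT).2⟩
    · exact ⟨k, ⟨hkT, hkA⟩, hk.1, fun h => hk.2 fun a ha => h a (by simpa using ha)⟩
    · simp only [value]
      rw [ep, em]
      exact pipage_value hf hyr.inBox hij p.2 (by exact_mod_cast hp) hpγ
  | leave N y T h =>
    obtain ⟨hN, hyr, hyu, hTE, hT⟩ := hs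
    refine goodStep_pure ⟨hN, hyr, hyu⟩ (measure_lt_of_remaining rfl ?_) le_rfl
    simp only [remaining]
    rw [if_neg (by push Not; exact h)]
    omega
  | halt N y hy =>
    obtain ⟨hN, hyr, hyu⟩ := hs
    have hind : ∀ i, y i = if i ∈ Finset.univ.filter (fun i => y i = 1) then 1 else 0 := by
      intro i
      have h01 : y i = 0 ∨ y i = 1 := by
        by_cases hi : i ∈ N.E
        · exact IsFractional.eq_of_not (hyr.1 i) (hyr.le_one i) (hy i hi)
        · exact Or.inl (eq_zero_of_notMem_ground hyr hi)
      rcases h01 with h | h <;> simp [h]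
    refine goodStep_pure ?_ (measure_lt_of_phase (by simp [phase]))
      (multilinearExt_indicator f _ hind).le
    -- For an integral point, the rank inequality of its support says that the support is
    -- independent.
    refine hN _ (indep_of_card_le_rank ?_)
    refine le_trans (le_of_eq ?_) (hyr.2 _)
    rw [Finset.card_eq_sum_ones, Nat.cast_sum]
    exact Finset.sum_congr rfl fun i hi => by simpa using (Finset.mem_filter.1 hi).2.symm

/-- The inner loop is the delicate case: tightness of T provides a second fractional variable
whenever there is one. -/
theorem Inv.exists_step {M : Matroid X} (f : Finset X → ℝ) {q : ℕ} {t : ℝ} (δ : ℝ) {s : State X}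
    (hs : Inv M q t s) : (∃ S, s = .done S) ∨ ∃ μ, Step M f t δ s μ := by
  cases s with
  | search x =>
    by_cases h : ∃ x', Improves M f t δ x x'
    · exact Or.inr ⟨_, .move x _ h.choose_spec⟩
    · exact Or.inr ⟨_, .localOpt x h⟩
  | adjust N x =>
    by_cases hx : x ∈ basePolytope N
    · exact Or.inr ⟨_, .adjusted N x hx⟩
    by_cases h : ∃ i ∈ N.E, ∃ ε : ℝ, 0 < ε ∧ x + ε • stdVec i ∈ polytope N
    · obtain ⟨i, hi, η, hη, hiη⟩ := h
      obtain ⟨ε, hε⟩ := exists_isGreatest_raise hs.2 i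
      have hε0 : 0 < ε := hη.trans_le (hε.2 hiη)
      have hxi := hs.2.1 i
      have h0 : 0 ≤ x i / (x i + ε) := by positivity
      have h1 : x i / (x i + ε) ≤ 1 := div_le_one_of_le₀ (by linarith) (by linarith)
      exact Or.inr ⟨_, .raise N x i ε ⟨_, h0⟩ h1 hx hi hε hε0 rfl⟩
    · exact Or.inr ⟨_, .noRaise N x hx h⟩
  | adjustDelete N x =>
    by_cases h : ∃ i ∈ N.E, x i = 0
    · obtain ⟨i, hi, hxi⟩ := h
      exact Or.inr ⟨_, .delete N x i hi hxi⟩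
    · push Not at h
      exact Or.inr ⟨_, .noDelete N x h⟩
  | outer N y =>
    by_cases h : ∃ i ∈ N.E, IsFractional (y i)
    · exact Or.inr ⟨_, .enter N y h⟩
    · push Not at h
      exact Or.inr ⟨_, .halt N y h⟩
  | inner N y T =>
    by_cases h : ∃ i ∈ T, IsFractional (y i)
    · obtain ⟨i, hi, hif⟩ := h
      obtain ⟨hN, hyr, hyu, hTE, hT⟩ := hs
      obtain ⟨A, rfl, hA⟩ := hT.resolve_right fun h => h i hi hif
      obtain ⟨j, hj, hij, hjf⟩ := hA.exists_second_fractional hyr hi hif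
      obtain ⟨yp, Ap, hyp⟩ := exists_hitConstraint N y (hTE hi) hij
      obtain ⟨ym, Am, hym⟩ := exists_hitConstraint N y (hTE hj) hij.symm
      obtain ⟨⟨γ, hγ, ep⟩, -⟩ := hyp.spec hyr hyu hij hif hjf hA hi hj
      obtain ⟨⟨γ', hγ', em⟩, -⟩ := hym.spec hyr hyu hij.symm hjf hif hA hj hi
      have hp0 : 0 ≤ γ / (γ + γ') := by positivity
      have hp1 : γ / (γ + γ') ≤ 1 := div_le_one_of_le₀ (by linarith) (by positivity)
      refine Or.inr ⟨_, .pipage N y A i j hij ⟨hi, hif⟩ ⟨hj, hjf⟩ yp ym Ap Am hyp hym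
        ⟨_, hp0⟩ hp1 ((pipage_norm_iff hij hγ hγ' ep em).2 ?_)⟩
      change γ / (γ + γ') * (γ + γ') = γ
      -- If γ + γ' = 0 then γ = 0 too, so the equation survives division by zero.
      refine div_mul_cancel_of_imp fun h => ?_
      linarith
    · push Not at h
      exact Or.inr ⟨_, .leave N y T h⟩
  | done S => exact Or.inl ⟨S, rfl⟩

theorem GoodStep.of_mem_support {M : Matroid X} {f : Finset X → ℝ} {q : ℕ} {t c : ℝ}
    {s s' : State X} {μ : PMF (State X)} (h : GoodStep M f q t c s μ) (hs' : s' ∈ μ.support) :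
    Inv M q t s' ∧ measure M f q t s' < measure M f q t s := by
  obtain ⟨p, hp, a, b, rfl, h1, h2, h3, h4, -⟩ := h
  rcases mem_support_coin.1 hs' with ⟨rfl, -⟩ | ⟨rfl, -⟩
  exacts [⟨h1, h3⟩, ⟨h2, h4⟩]

/-- A transition system whose steps are all good halts, whatever the choices. -/
theorem alwaysHalts_of_goodStep {M : Matroid X} {f : Finset X → ℝ} {q : ℕ} {t c : ℝ}
    {step : State X → PMF (State X) → Prop}
    (hgood : ∀ s μ, step s μ → Inv M q t s → GoodStep M f q t c s μ)
    (hprog : ∀ s, Inv M q t s → (∃ S, s = .done S) ∨ ∃ μ, step s μ)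
    {s₀ : State X} (h0 : Inv M q t s₀) : AlwaysHalts step s₀ := by
  have hsucc : ∀ s s', Succ step s s' → Inv M q t s →
      Inv M q t s' ∧ measure M f q t s' < measure M f q t s := by
    rintro s s' ⟨μ, hμ, hs'⟩ hs
    exact (hgood s μ hμ hs).of_mem_support hs'
  constructor
  · rintro ⟨s, rfl, hs⟩
    have hinv : ∀ n, Inv M q t (s n) := fun n => by
      induction n with
      | zero => exact h0
      | succ n ih => exact (hsucc _ _ (hs n) ih).1
    obtain ⟨n, hn⟩ := WellFounded.not_rel_apply_succ (r := (· < ·))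
      fun n => measure M f q t (s n)
    exact hn (hsucc _ _ (hs n) (hinv n)).2
  · intro s hs
    refine hprog s ?_
    induction hs with
    | refl => exact h0
    | tail _ h ih => exact (hsucc _ _ h ih).1

/-- The output of a transition system whose steps are all good. -/
theorem output_of_goodStep {M : Matroid X} {f : Finset X → ℝ} {q : ℕ} {t c : ℝ}
    {step : State X → PMF (State X) → Prop}
    (hgood : ∀ s μ, step s μ → Inv M q t s → GoodStep M f q t c s μ)
    {s : State X} {ν : PMF (Finset X)} (h : Output step s ν) (hs : Inv M q t s) :
    (∀ S ∈ ν.support, M.Indep (S : Set X)) ∧ value f c s ≤ expectedValue f ν := by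
  induction h with
  | done S =>
    refine ⟨fun S' hS' => ?_, ?_⟩
    · rw [PMF.support_pure, Set.mem_singleton_iff] at hS'
      rw [hS']; exact hs
    · refine le_of_eq ?_
      unfold expectedValue
      rw [Finset.sum_eq_single S]
      · simp [value]
      · intro S' _ hS'; simp [PMF.pure_apply, hS']
      · simp
  | step s μ ν hμ hν ih =>
    have hg := hgood s μ hμ hs
    constructor
    · intro S hS
      obtain ⟨s', hs', hS'⟩ := (PMF.mem_support_bind_iff _ _ _).1 hS
      exact (ih s' hs' (hg.of_mem_support hs').1).1 S hS'
    · obtain ⟨p, hp, a, b, rfl, h1, h2, -, -, h3⟩ := hg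
      rw [expectedValue_coin_bind]
      refine h3.trans (add_le_add ?_ ?_)
      -- An outcome of probability zero is outside the support, so nothing is known about its
      -- output; its term vanishes.
      · by_cases h : p = 0
        · simp [h]
        · exact mul_le_mul_of_nonneg_left
            (ih a (mem_support_coin.2 (Or.inl ⟨rfl, h⟩)) h1).2 p.2
      · have hp' : (0 : ℝ) ≤ 1 - p := sub_nonneg.2 (by exact_mod_cast hp)
        by_cases h : 1 - p = 0
        · have : (1 : ℝ) - p = 0 := by
            rw [← NNReal.coe_one, ← NNReal.coe_sub hp, h, NNReal.coe_zero]
          simp [this]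
        · exact mul_le_mul_of_nonneg_left
            (ih b (mem_support_coin.2 (Or.inr ⟨rfl, h⟩)) h2).2 hp'

end Algorithm

end FractionalSearch

/-! ### The approximation guarantee -/

theorem theorem4p1 {X : Type*} [Fintype X] [DecidableEq X] (M : Matroid X)
    (hE : M.E = Set.univ) (f : Finset X → ℝ) (hf_nonneg : ∀ S, 0 ≤ f S)
    (hf_submod : FractionalSearch.IsSubmodular f)
    (r q : ℕ) (hq : 0 < q) (hrq : r ≤ q) (t : ℝ) (ht : t = (r : ℝ) / (q : ℝ))
    (ht_mem : t ∈ Set.Icc (0 : ℝ) ((3 - Real.sqrt 5) / 2))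
    (OPT : ℝ) (hOPT : IsGreatest {a : ℝ | ∃ S : Finset X, M.Indep (S : Set X) ∧ a = f S} OPT) :
    FractionalSearch.AlwaysHalts (FractionalSearch.Step M f t (1 / (q : ℝ)))
      (FractionalSearch.State.search 0) ∧
    ∀ ν : PMF (Finset X),
      FractionalSearch.Output (FractionalSearch.Step M f t (1 / (q : ℝ)))
        (FractionalSearch.State.search 0) ν →
      (∀ S ∈ ν.support, M.Indep (S : Set X)) ∧
      (t - t ^ 2 / 2) * OPT ≤ FractionalSearch.expectedValue f ν := by
  -- Only attainment of OPT matters: the bound holds relative to every independent C.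
  obtain ⟨⟨C, hC, rfl⟩, -⟩ := hOPT
  have htq : FractionalSearch.IsMultiple q t := ⟨r, by rw [ht]; simp⟩
  have h0 : FractionalSearch.Inv M q t (.search 0) :=
    ⟨fun _ => FractionalSearch.isMultiple_zero q, FractionalSearch.mem_boxedPolytope_iff.2
      ⟨⟨fun _ => le_rfl, fun A => by simpa using FractionalSearch.rank_nonneg M A⟩,
        fun _ => ht_mem.1⟩⟩
  have hgood : ∀ s μ, FractionalSearch.Step M f t (1 / (q : ℝ)) s μ →
      FractionalSearch.Inv M q t s →
      FractionalSearch.GoodStep M f q t ((t - t ^ 2 / 2) * f C) s μ :=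
    fun s μ h hs => h.goodStep hf_submod hq (fun x hx hxb hopt =>
      FractionalSearch.localOpt_ge hf_nonneg hf_submod hq htq ht_mem hx hxb hopt hC) hs
  exact ⟨FractionalSearch.alwaysHalts_of_goodStep hgood (fun s hs => hs.exists_step f _) h0,
    fun ν hν => FractionalSearch.output_of_goodStep hgood hν h0⟩
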